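/- Let $\chi:\mathbb{R}\to\mathbb{R}$ be measurable with $0\le\chi(x)\le c\,(1+x^2)^{-3\alpha/2}$ for some constants $c$ and $\alpha>1$. For $s,t\in\mathbb{R}$ let $(1-\Delta)^{s/2}$ and $L(t)=e^{-it\sqrt{1-\Delta}}$ be the Fourier multipliers on tempered distributions on $\mathbb{R}$ with symbols $(1+n^2)^{s/2}$ and $e^{-it\sqrt{1+n^2}}$, let $\|f\|_{H^1}=\|(1-\Delta)^{1/2}f\|_{L^2}$, and let $H^{1/2-}_{\rm loc}$ be the space of tempered distributions $u$ such that $(1-\Delta)^{s/2}u\in L^2([-R,R])$ for all $s<1/2$ and all $R>0$. There is a constant $C\ge1$, depending only on $\chi$, such that the following holds for all $\Lambda\ge1$ and all $0<\varepsilon\le\sqrt{\Lambda}$ (in particular for all $0<\varepsilon\le1$), with $T=\varepsilon^2/(C\Lambda^4)$. For every $u_0\in H^{1/2-}_{\rm loc}$ with $$\big\|\chi^{1/3}\,|L(\tau)u_0|\big\|_{L^6_\tau([-1,1]),\,L^6_x(\mathbb{R})}\le\Lambda ,$$ the Cauchy problem $$i\partial_t u=\sqrt{1-\Delta}\,u+(1-\Delta)^{-1/2}\big(\chi(\mathrm{Re}\,u)^3\big),\qquad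 u|_{t=0}=u_0,$$ understood in the sense of tempered distributions, integrated in time, has a unique solution $t\mapsto\psi(t)u_0$ on $[-T,T]$ in the class $L(t)u_0+\mathcal{C}([-T,T],H^1)$, and for all $t\in[-T,T]$ $$\|\psi(t)u_0-L(t)u_0\|_{H^1}\le\varepsilon\Lambda .$$ -/

import Mathlib

open MeasureTheory Set
open scoped SchwartzMap ENNReal

noncomputable section

namespace KleinGordon

/-- The symbol `√(1 + n²)` of `√(1 - Δ)`. Mathlib's Fourier transform has the kernel
`exp (-2πi x ξ)`, so the frequency `n` of the kernel `exp (-i n x)` is `n = 2πξ`. -/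
def japaneseBracket (ξ : ℝ) : ℝ := √(1 + (2 * Real.pi * ξ) ^ 2)

/-- The operator `D^s = (1 - Δ)^{s/2}` on tempered distributions on the line. -/
def D (s : ℝ) : 𝓢'(ℝ, ℂ) →L[ℂ] 𝓢'(ℝ, ℂ) :=
  TemperedDistribution.fourierMultiplierCLM ℂ fun ξ ↦ ((japaneseBracket ξ ^ s : ℝ) : ℂ)

/-- The linear flow `L(t) = exp (-i t √(1 - Δ))` on tempered distributions on the line. -/
def L (t : ℝ) : 𝓢'(ℝ, ℂ) →L[ℂ] 𝓢'(ℝ, ℂ) :=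
  TemperedDistribution.fourierMultiplierCLM ℂ fun ξ ↦
    Complex.exp (-(Complex.I * (t : ℂ) * (japaneseBracket ξ : ℂ)))

/-- The tempered distribution `S` is the locally integrable function `f`. -/
def IsFunction (S : 𝓢'(ℝ, ℂ)) (f : ℝ → ℂ) : Prop :=
  LocallyIntegrable f volume ∧
    ∀ φ : 𝓢(ℝ, ℂ), HasCompactSupport φ → S φ = ∫ x, φ x * f x

/-- Membership in `H^{1/2-}_loc`: for every `s < 1/2` the distribution `(1 - Δ)^{s/2} u` is a
function that is square integrable on every interval `[-R, R]`. -/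
def MemHHalfLoc (u : 𝓢'(ℝ, ℂ)) : Prop :=
  ∀ s : ℝ, s < 1 / 2 → ∃ g : ℝ → ℂ, IsFunction (D s u) g ∧
    ∀ R : ℝ, MemLp g 2 (volume.restrict (Icc (-R) R))

/-- The bound `‖χ^{1/3} |L(τ) u₀|‖_{L^6_τ([-1,1]), L^6_x(ℝ)} ≤ Λ`. The function `z` is the
(almost everywhere unique) function `(τ, x) ↦ (L(τ) u₀)(x)`. -/
def LinearFlowBound (χ : ℝ → ℝ) (u₀ : 𝓢'(ℝ, ℂ)) (Λ : ℝ) : Prop :=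
  ∃ z : ℝ → ℝ → ℂ, Measurable (Function.uncurry z) ∧
    (∀ᵐ τ ∂(volume.restrict (Icc (-1 : ℝ) 1)), IsFunction (L τ u₀) (z τ)) ∧
    eLpNorm (fun τ ↦ eLpNorm (fun x ↦ χ x ^ (1 / 3 : ℝ) * ‖z τ x‖) 6 volume) 6
      (volume.restrict (Icc (-1 : ℝ) 1)) ≤ ENNReal.ofReal Λ

/-- The norm `‖f‖_{H^1} = ‖(1 - Δ)^{1/2} f‖_{L^2}`, which is `∞` if `f` is not in `H^1`. -/
def h1Norm (f : 𝓢'(ℝ, ℂ)) : ℝ≥0∞ :=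
  ⨅ (g : Lp ℂ 2 (volume : Measure ℝ)) (_ : D 1 f = g), ‖g‖ₑ

/-- `v` is a continuous map from `[-T, T]` to `H^1`. Since `(1 - Δ)^{1/2}` is an isometry of `H^1`
onto `L^2`, this is the continuity of `t ↦ (1 - Δ)^{1/2} v(t)` with values in `L^2`. -/
def IsContinuousInH1 (T : ℝ) (v : ℝ → 𝓢'(ℝ, ℂ)) : Prop :=
  ∃ V : ℝ → Lp ℂ 2 (volume : Measure ℝ), ContinuousOn V (Icc (-T) T) ∧
    ∀ t ∈ Icc (-T) T, D 1 (v t) = V t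

/-- `u` solves on `[-T, T]` the Cauchy problem
`i ∂ₜ u = √(1 - Δ) u + (1 - Δ)^{-1/2} (χ (Re u)³)`, `u(0) = u₀`, in the sense of tempered
distributions, integrated in time. Here `N τ` is the distribution `χ (Re u(τ))³`. -/
def IsSolution (χ : ℝ → ℝ) (u₀ : 𝓢'(ℝ, ℂ)) (T : ℝ) (u : ℝ → 𝓢'(ℝ, ℂ)) : Prop :=
  u 0 = u₀ ∧ ∃ N : ℝ → 𝓢'(ℝ, ℂ),
    (∀ᵐ τ ∂(volume.restrict (Icc (-T) T)), ∃ f : ℝ → ℂ, IsFunction (u τ) f ∧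
      IsFunction (N τ) fun x ↦ ((χ x * (f x).re ^ 3 : ℝ) : ℂ)) ∧
    ∀ φ : 𝓢(ℝ, ℂ),
      IntervalIntegrable (fun τ ↦ (D 1 (u τ) + D (-1) (N τ)) φ) volume (-T) T ∧
      ∀ t ∈ Icc (-T) T,
        Complex.I * (u t φ - u 0 φ) = ∫ τ in (0 : ℝ)..t, (D 1 (u τ) + D (-1) (N τ)) φ

end KleinGordon

end

noncomputable section

namespace KleinGordon

open Filter Topology
open scoped FourierTransform ContDiff BoundedContinuousFunction InnerProductSpace ComplexConjugate

/-! ### Symbols -/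

/-! Write D = √(1-Δ) and look for the solution as u(t) = L(t)u₀ + D⁻¹V(t) with V continuous into L².
Subtracting the linear flow turns the equation into i D⁻¹V' = V + D⁻¹n(t,V), that is, V(t) = -i ∫₀ᵗ
L(t-τ) n(τ,V(τ)) dτ with n(τ,V) = χ (Re(z(τ) + D⁻¹V))³ and z(τ) = L(τ)u₀. This is solved by
contraction in the ball of radius R = εΛ.

In dimension one (1+n²)^{-1/2} lies in L², so D⁻¹V is a continuous function bounded by κ‖V‖
(`norm_besselFun_le`). With b(τ) = ‖χ|z(τ)|³‖ in L², this gives ‖n(τ,V)‖ ≤ 4b(τ) + 4(κ‖V‖)³‖χ‖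
(`norm_source_le`); the decay of χ enters only through χ ∈ L². The hypothesis on z says ∫b² ≤ Λ⁶
over [-1,1], hence ∫b ≤ 3√T Λ³ over [-T,T] (`lintegral_cubeNorm_le`). Since √T Λ³ is εΛ divided by
√C, a large C makes the Duhamel map preserve the ball. The Lipschitz bound involves χ|z|², which is
dominated by μ²χ + χ|z|³/μ with a free parameter μ (`norm_source_sub_le`).

A mild solution solves the equation by Fubini on a triangle (`I_smul_bessel_duhamel`). Conversely, a
distributional solution in the class is mild, because the difference of two candidates satisfies a
linear equation with a conserved L² norm (`eq_zero_of_I_smul_bessel_eq`). Uniqueness in the full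
class, not only in the ball, then follows from Grönwall's inequality with an integrable kernel
(`mild_solution_unique`). -/

theorem japaneseBracket_sq (ξ : ℝ) : japaneseBracket ξ ^ 2 = 1 + (2 * Real.pi * ξ) ^ 2 :=
  Real.sq_sqrt (by positivity)

theorem one_le_japaneseBracket (ξ : ℝ) : 1 ≤ japaneseBracket ξ :=
  Real.one_le_sqrt.2 (by nlinarith [sq_nonneg (2 * Real.pi * ξ)])

theorem japaneseBracket_pos (ξ : ℝ) : 0 < japaneseBracket ξ :=
  one_pos.trans_le (one_le_japaneseBracket ξ)

theorem hasTemperateGrowth_japaneseBracket_rpow (s : ℝ) :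
    (fun ξ ↦ japaneseBracket ξ ^ s).HasTemperateGrowth := by
  have h₁ : (fun ξ : ℝ ↦ 2 * Real.pi * ξ).HasTemperateGrowth := by fun_prop
  have h := (Function.hasTemperateGrowth_one_add_norm_sq_rpow ℝ (s / 2)).comp h₁
  convert! h using 1
  ext ξ
  simp only [japaneseBracket, Function.comp, Real.norm_eq_abs, sq_abs]
  rw [Real.sqrt_eq_rpow, ← Real.rpow_mul (by positivity)]
  ring_nf

theorem hasTemperateGrowth_japaneseBracket : japaneseBracket.HasTemperateGrowth := by
  simpa using hasTemperateGrowth_japaneseBracket_rpow 1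

theorem hasTemperateGrowth_ofReal_japaneseBracket_rpow (s : ℝ) :
    (fun ξ ↦ ((japaneseBracket ξ ^ s : ℝ) : ℂ)).HasTemperateGrowth :=
  Function.Complex.hasTemperateGrowth_ofReal.comp (hasTemperateGrowth_japaneseBracket_rpow s)

/-- The derivative of the symbol `√(1 + n²)` with respect to `ξ`, where `n = 2πξ`. -/
def japaneseBracketDeriv (ξ : ℝ) : ℝ := (2 * Real.pi) ^ 2 * ξ * japaneseBracket ξ ^ (-1 : ℝ)

theorem hasTemperateGrowth_japaneseBracketDeriv : japaneseBracketDeriv.HasTemperateGrowth := by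
  have h₁ : (fun ξ : ℝ ↦ (2 * Real.pi) ^ 2 * ξ).HasTemperateGrowth := by fun_prop
  exact h₁.mul (hasTemperateGrowth_japaneseBracket_rpow (-1))

theorem hasDerivAt_japaneseBracket (ξ : ℝ) :
    HasDerivAt japaneseBracket (japaneseBracketDeriv ξ) ξ := by
  have h₁ : HasDerivAt (fun ξ : ℝ ↦ 1 + (2 * Real.pi * ξ) ^ 2)
      (2 * (2 * Real.pi * ξ) * (2 * Real.pi)) ξ := by
    have := (((hasDerivAt_id ξ).const_mul (2 * Real.pi)).pow 2).const_add 1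
    convert! this using 1
    simp
  have h := h₁.sqrt (by positivity)
  convert! h using 1
  have := japaneseBracket_pos ξ
  rw [japaneseBracketDeriv, Real.rpow_neg_one]
  change _ = _ / (2 * japaneseBracket ξ)
  field_simp

/-- The symbol `exp (-i t √(1 + n²))` of the linear flow. -/
def phase (t ξ : ℝ) : ℂ := Complex.exp (-(Complex.I * (t : ℂ) * (japaneseBracket ξ : ℂ)))

theorem hasTemperateGrowth_cexp_mul_I (t : ℝ) :
    (fun x : ℝ ↦ Complex.exp (-(Complex.I * (t : ℂ) * (x : ℂ)))).HasTemperateGrowth := by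
  have hderiv : ∀ n : ℕ, iteratedDeriv n
      (fun x : ℝ ↦ Complex.exp (-(Complex.I * (t : ℂ) * (x : ℂ)))) =
      fun x : ℝ ↦ (-(Complex.I * t)) ^ n * Complex.exp (-(Complex.I * (t : ℂ) * (x : ℂ))) := by
    intro n
    induction n with
    | zero => simp
    | succ n ih =>
      rw [iteratedDeriv_succ, ih]
      ext x
      have h : HasDerivAt (fun x : ℝ ↦ -(Complex.I * (t : ℂ) * (x : ℂ)))
          (-(Complex.I * (t : ℂ) * 1)) x :=
        ((Complex.ofRealCLM.hasDerivAt (x := x)).const_mul (Complex.I * (t : ℂ))).neg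
      rw [(h.cexp.const_mul _).deriv]
      ring
  refine ⟨Complex.contDiff_exp.comp ((contDiff_const.mul Complex.ofRealCLM.contDiff).neg), fun n ↦ ⟨0, ‖(-(Complex.I * (t : ℂ))) ^ n‖, fun x ↦ ?_⟩⟩
  rw [norm_iteratedFDeriv_eq_norm_iteratedDeriv, hderiv, norm_mul]
  have : ‖Complex.exp (-(Complex.I * (t : ℂ) * (x : ℂ)))‖ = 1 := by
    rw [Complex.norm_exp]; simp
  rw [this]; simp

theorem hasTemperateGrowth_phase (t : ℝ) : (phase t).HasTemperateGrowth :=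
  (hasTemperateGrowth_cexp_mul_I t).comp hasTemperateGrowth_japaneseBracket

@[simp]
theorem norm_phase (t ξ : ℝ) : ‖phase t ξ‖ = 1 := by
  rw [phase, Complex.norm_exp]; simp

@[simp]
theorem phase_zero : phase 0 = fun _ ↦ 1 := by
  ext ξ; simp [phase]

theorem phase_add (s t : ℝ) : phase (s + t) = phase s * phase t := by
  ext ξ
  rw [Pi.mul_apply, phase, phase, phase, ← Complex.exp_add]
  congr 1; push_cast; ring

theorem hasDerivAt_phase_time (t ξ : ℝ) :
    HasDerivAt (fun t ↦ phase t ξ) (-(Complex.I * japaneseBracket ξ) * phase t ξ) t := by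
  have h : HasDerivAt (fun t : ℝ ↦ -(Complex.I * (t : ℂ) * (japaneseBracket ξ : ℂ)))
      (-(Complex.I * 1 * (japaneseBracket ξ : ℂ))) t :=
    (((Complex.ofRealCLM.hasDerivAt (x := t)).const_mul Complex.I).mul_const _).neg
  convert! h.cexp using 1
  rw [phase]; ring

theorem D_eq (s : ℝ) : D s = TemperedDistribution.fourierMultiplierCLM ℂ
    fun ξ ↦ ((japaneseBracket ξ ^ s : ℝ) : ℂ) := rfl

theorem L_eq (t : ℝ) : L t = TemperedDistribution.fourierMultiplierCLM ℂ (phase t) := rfl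

theorem D_D (s s' : ℝ) (u : 𝓢'(ℝ, ℂ)) : D s (D s' u) = D (s' + s) u := by
  rw [D_eq, D_eq, D_eq, TemperedDistribution.fourierMultiplierCLM_fourierMultiplierCLM_apply
    (hasTemperateGrowth_ofReal_japaneseBracket_rpow s')
    (hasTemperateGrowth_ofReal_japaneseBracket_rpow s)]
  congr 2
  ext ξ
  simp [Real.rpow_add (japaneseBracket_pos ξ)]

theorem D_zero (u : 𝓢'(ℝ, ℂ)) : D 0 u = u := by
  rw [D_eq]; simp

theorem D_one_D_neg_one (u : 𝓢'(ℝ, ℂ)) : D 1 (D (-1) u) = u := by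
  rw [D_D]; simp [D_zero]

theorem D_neg_one_D_one (u : 𝓢'(ℝ, ℂ)) : D (-1) (D 1 u) = u := by
  rw [D_D]; simp [D_zero]

theorem L_zero (u : 𝓢'(ℝ, ℂ)) : L 0 u = u := by
  rw [L_eq, phase_zero]; simp

/-! ### The linear flow on tempered distributions is differentiable in time -/

/-- The second order Taylor remainder of `exp (-i h √(1 + n²))` at `h = 0`. -/
def phaseRemainder (h ξ : ℝ) : ℂ := phase h ξ - 1 + Complex.I * h * japaneseBracket ξ

theorem hasTemperateGrowth_phaseRemainder (h : ℝ) : (phaseRemainder h).HasTemperateGrowth := by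
  have h₁ := hasTemperateGrowth_phase h
  have h₂ := Function.Complex.hasTemperateGrowth_ofReal.comp hasTemperateGrowth_japaneseBracket
  have h₃ : (fun ξ ↦ phase h ξ - 1).HasTemperateGrowth := h₁.sub (.const 1)
  have h₄ : (fun ξ ↦ Complex.I * h * (japaneseBracket ξ : ℂ)).HasTemperateGrowth :=
    (Function.HasTemperateGrowth.const (Complex.I * (h : ℂ))).mul h₂
  exact h₃.add h₄

/-- Taylor's formula covers |h|⟨ξ⟩ ≤ 1. For larger values the triangle inequality gives a linear
bound, which the quadratic one dominates. -/
theorem norm_phaseRemainder_le (h ξ : ℝ) :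
    ‖phaseRemainder h ξ‖ ≤ 2 * h ^ 2 * japaneseBracket ξ ^ 2 := by
  set x : ℝ := -(h * japaneseBracket ξ) with hx
  have e₁ : phase h ξ = Complex.exp (Complex.I * (x : ℂ)) := by
    rw [phase, hx]; congr 1; push_cast; ring
  have e₂ : phaseRemainder h ξ = Complex.exp (Complex.I * (x : ℂ)) - 1 - Complex.I * x := by
    rw [phaseRemainder, e₁, hx]; push_cast; ring
  have e₃ : 2 * h ^ 2 * japaneseBracket ξ ^ 2 = 2 * |x| ^ 2 := by rw [sq_abs, hx]; ring
  have e₄ : ‖Complex.I * (x : ℂ)‖ = |x| := by simp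
  rw [e₂, e₃]
  rcases le_total |x| 1 with h1 | h1
  · have := Complex.norm_exp_sub_one_sub_id_le (x := Complex.I * (x : ℂ)) (by rwa [e₄])
    rw [e₄] at this
    nlinarith [sq_nonneg |x|]
  · have h2 := norm_sub_le (Complex.exp (Complex.I * (x : ℂ)) - 1) (Complex.I * x)
    have h3 : ‖Complex.exp (Complex.I * (x : ℂ)) - 1‖ ≤ |x| :=
      Real.norm_exp_I_mul_ofReal_sub_one_le
    rw [e₄] at h2
    nlinarith

/-- The derivative is again a multiple of the remainder plus an explicit term of size h², which is
what closes the induction on the order of differentiation. -/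
theorem hasDerivAt_phaseRemainder (h ξ : ℝ) :
    HasDerivAt (phaseRemainder h) (-(Complex.I * h * japaneseBracketDeriv ξ) *
      (phaseRemainder h ξ - Complex.I * h * japaneseBracket ξ)) ξ := by
  have h₀ : HasDerivAt (fun ξ ↦ (japaneseBracket ξ : ℂ)) (japaneseBracketDeriv ξ : ℂ) ξ :=
    (hasDerivAt_japaneseBracket ξ).ofReal_comp
  have h₁ : HasDerivAt (fun ξ ↦ Complex.I * (h : ℂ) * (japaneseBracket ξ : ℂ))
    (Complex.I * h * japaneseBracketDeriv ξ) ξ := h₀.const_mul (Complex.I * (h : ℂ))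
  have h₂ := (h₁.neg.cexp.sub_const 1).add h₁
  convert! h₂ using 1
  simp only [phaseRemainder, phase, Pi.neg_apply]
  ring

theorem seminorm_succ_eq (k n : ℕ) (f : 𝓢(ℝ, ℂ)) :
    SchwartzMap.seminorm ℝ k (n + 1) f =
      SchwartzMap.seminorm ℝ k n (SchwartzMap.derivCLM ℝ ℂ f) := by
  have key : ∀ x, iteratedDeriv (n + 1) f x = iteratedDeriv n (SchwartzMap.derivCLM ℝ ℂ f) x := by
    intro x
    rw [iteratedDeriv_succ']
    rfl
  apply le_antisymm
  · refine SchwartzMap.seminorm_le_bound' ℝ _ _ _ (by positivity) fun x ↦ ?_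
    rw [key]
    exact SchwartzMap.le_seminorm' ℝ _ _ _ x
  · refine SchwartzMap.seminorm_le_bound' ℝ _ _ _ (by positivity) fun x ↦ ?_
    rw [← key]
    exact SchwartzMap.le_seminorm' ℝ _ _ _ x

/-- Induction on the number of derivatives, for all ψ at once: differentiating the product produces
the remainder times other Schwartz functions, and one term with an explicit h². -/
theorem exists_seminorm_phaseRemainder_le (n k : ℕ) (ψ : 𝓢(ℝ, ℂ)) :
    ∃ C, 0 ≤ C ∧ ∀ h : ℝ, |h| ≤ 1 → SchwartzMap.seminorm ℝ k n
      (SchwartzMap.smulLeftCLM ℂ (phaseRemainder h) ψ) ≤ C * h ^ 2 := by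
  have hm : (fun ξ ↦ (japaneseBracket ξ : ℂ)).HasTemperateGrowth :=
    Function.Complex.hasTemperateGrowth_ofReal.comp hasTemperateGrowth_japaneseBracket
  have hm' : (fun ξ ↦ (japaneseBracketDeriv ξ : ℂ)).HasTemperateGrowth :=
    Function.Complex.hasTemperateGrowth_ofReal.comp hasTemperateGrowth_japaneseBracketDeriv
  induction n generalizing ψ with
  | zero =>
    set ψ₂ := SchwartzMap.smulLeftCLM ℂ (fun ξ ↦ (japaneseBracket ξ : ℂ))
      (SchwartzMap.smulLeftCLM ℂ (fun ξ ↦ (japaneseBracket ξ : ℂ)) ψ) with hψ₂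
    refine ⟨2 * SchwartzMap.seminorm ℝ k 0 ψ₂, by positivity, fun h hh ↦ ?_⟩
    refine SchwartzMap.seminorm_le_bound' ℝ _ _ _ (by positivity) fun x ↦ ?_
    have h1 := SchwartzMap.le_seminorm' ℝ k 0 ψ₂ x
    rw [iteratedDeriv_zero] at h1 ⊢
    rw [SchwartzMap.smulLeftCLM_apply_apply (hasTemperateGrowth_phaseRemainder h), norm_smul]
    rw [hψ₂, SchwartzMap.smulLeftCLM_apply_apply hm, SchwartzMap.smulLeftCLM_apply_apply hm,
      norm_smul, norm_smul, ← hψ₂, Complex.norm_real, Real.norm_eq_abs,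
      abs_of_pos (japaneseBracket_pos x)] at h1
    calc |x| ^ k * (‖phaseRemainder h x‖ * ‖ψ x‖)
        ≤ |x| ^ k * ((2 * h ^ 2 * japaneseBracket x ^ 2) * ‖ψ x‖) := by
          gcongr; exact norm_phaseRemainder_le h x
      _ = 2 * (|x| ^ k * (japaneseBracket x * (japaneseBracket x * ‖ψ x‖))) * h ^ 2 := by ring
      _ ≤ _ := by gcongr
  | succ n ih =>
    obtain ⟨C₁, hC₁, h₁⟩ := ih (SchwartzMap.derivCLM ℝ ℂ ψ)
    set ψ₁ := SchwartzMap.smulLeftCLM ℂ (fun ξ ↦ (japaneseBracketDeriv ξ : ℂ)) ψ with hψ₁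
    set ψ₂ := SchwartzMap.smulLeftCLM ℂ (fun ξ ↦ (japaneseBracket ξ : ℂ)) ψ₁ with hψ₂
    obtain ⟨C₂, hC₂, h₂⟩ := ih ψ₁
    refine ⟨C₁ + C₂ + SchwartzMap.seminorm ℝ k n ψ₂, by positivity, fun h hh ↦ ?_⟩
    have hr := hasTemperateGrowth_phaseRemainder h
    have key : SchwartzMap.derivCLM ℝ ℂ (SchwartzMap.smulLeftCLM ℂ (phaseRemainder h) ψ) =
        SchwartzMap.smulLeftCLM ℂ (phaseRemainder h) (SchwartzMap.derivCLM ℝ ℂ ψ) +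
        (-(Complex.I * h)) • SchwartzMap.smulLeftCLM ℂ (phaseRemainder h) ψ₁ +
        (-(h : ℂ) ^ 2) • ψ₂ := by
      ext x
      have hd : HasDerivAt (SchwartzMap.smulLeftCLM ℂ (phaseRemainder h) ψ)
          (-(Complex.I * h * japaneseBracketDeriv x) *
            (phaseRemainder h x - Complex.I * h * japaneseBracket x) * ψ x
            + phaseRemainder h x * deriv ψ x) x := by
        have := (hasDerivAt_phaseRemainder h x).mul (ψ.hasDerivAt x)
        convert! this using 1
        ext y
        simp [SchwartzMap.smulLeftCLM_apply_apply hr]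
      rw [SchwartzMap.derivCLM_apply, hd.deriv]
      simp only [hψ₂, hψ₁, add_apply, smul_apply,
        SchwartzMap.smulLeftCLM_apply_apply hr, SchwartzMap.smulLeftCLM_apply_apply hm,
        SchwartzMap.smulLeftCLM_apply_apply hm', SchwartzMap.derivCLM_apply, smul_eq_mul]
      linear_combination (h ^ 2 * (japaneseBracketDeriv x : ℂ) * japaneseBracket x * ψ x) *
        Complex.I_sq
    rw [seminorm_succ_eq, key]
    have hsm : ∀ (c : ℂ) (f : 𝓢(ℝ, ℂ)), SchwartzMap.seminorm ℝ k n (c • f) ≤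
        ‖c‖ * SchwartzMap.seminorm ℝ k n f := fun c f ↦
      (map_smul_eq_mul (SchwartzMap.seminorm ℂ k n) c f).le
    refine (map_add_le_add _ _ _).trans ?_
    have t1 := map_add_le_add (SchwartzMap.seminorm ℝ k n)
      (SchwartzMap.smulLeftCLM ℂ (phaseRemainder h) (SchwartzMap.derivCLM ℝ ℂ ψ))
      ((-(Complex.I * h)) • SchwartzMap.smulLeftCLM ℂ (phaseRemainder h) ψ₁)
    have t2 := hsm (-(Complex.I * h)) (SchwartzMap.smulLeftCLM ℂ (phaseRemainder h) ψ₁)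
    have t3 := hsm (-(h : ℂ) ^ 2) ψ₂
    have e2 : ‖-(Complex.I * (h : ℂ))‖ = |h| := by simp
    have e3 : ‖-(h : ℂ) ^ 2‖ = h ^ 2 := by simp
    rw [e2] at t2
    rw [e3] at t3
    have t4 := h₁ h hh
    have t5 := h₂ h hh
    have t6 : |h| * SchwartzMap.seminorm ℝ k n (SchwartzMap.smulLeftCLM ℂ (phaseRemainder h) ψ₁)
        ≤ 1 * (C₂ * h ^ 2) := mul_le_mul hh t5 (by positivity) zero_le_one
    linarith

theorem tendsto_slope_phase (ψ : 𝓢(ℝ, ℂ)) :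
    Tendsto (fun h : ℝ ↦ h⁻¹ • (SchwartzMap.smulLeftCLM ℂ (phase h) ψ - ψ)) (𝓝[≠] 0)
      (𝓝 ((-Complex.I) • SchwartzMap.smulLeftCLM ℂ (fun ξ ↦ (japaneseBracket ξ : ℂ)) ψ)) := by
  have hm : (fun ξ ↦ (japaneseBracket ξ : ℂ)).HasTemperateGrowth :=
    Function.Complex.hasTemperateGrowth_ofReal.comp hasTemperateGrowth_japaneseBracket
  rw [(schwartz_withSeminorms ℝ ℝ ℂ).tendsto_nhds]
  rintro ⟨k, n⟩ ε hε
  obtain ⟨C, hC, hb⟩ := exists_seminorm_phaseRemainder_le n k ψ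
  have hev : ∀ᶠ h : ℝ in 𝓝 0, |h| ≤ 1 ∧ C * |h| < ε := by
    have c1 : Tendsto (fun h : ℝ ↦ |h|) (𝓝 0) (𝓝 0) := by
      simpa using (continuous_abs.tendsto (0 : ℝ))
    have c2 : Tendsto (fun h : ℝ ↦ C * |h|) (𝓝 0) (𝓝 0) := by simpa using c1.const_mul C
    exact (c1.eventually_le_const one_pos).and (c2.eventually_lt_const hε)
  filter_upwards [nhdsWithin_le_nhds hev, self_mem_nhdsWithin] with h hh hne
  have hne : h ≠ 0 := hne
  have key : h⁻¹ • (SchwartzMap.smulLeftCLM ℂ (phase h) ψ - ψ) -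
      (-Complex.I) • SchwartzMap.smulLeftCLM ℂ (fun ξ ↦ (japaneseBracket ξ : ℂ)) ψ =
      h⁻¹ • SchwartzMap.smulLeftCLM ℂ (phaseRemainder h) ψ := by
    ext x
    simp only [sub_apply, smul_apply, SchwartzMap.smulLeftCLM_apply_apply hm,
      SchwartzMap.smulLeftCLM_apply_apply (hasTemperateGrowth_phase h),
      SchwartzMap.smulLeftCLM_apply_apply (hasTemperateGrowth_phaseRemainder h), phaseRemainder,
      smul_eq_mul, Complex.real_smul, Complex.ofReal_inv]
    have : (h : ℂ) ≠ 0 := by exact_mod_cast hne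
    field_simp
    ring
  rw [key, SchwartzMap.schwartzSeminormFamily_apply, map_smul_eq_mul, norm_inv, Real.norm_eq_abs]
  have hpos : 0 < |h| := abs_pos.2 hne
  have := hb h hh.1
  rw [← sq_abs] at this
  calc |h|⁻¹ * _ ≤ |h|⁻¹ * (C * |h| ^ 2) := by gcongr
    _ = C * |h| := by field_simp
    _ < ε := hh.2

/-- By duality the multiplier acts on the test function, where the difference quotients converge in
the Schwartz topology by `tendsto_slope_phase`; continuity of u does the rest. -/
theorem hasDerivAt_L_apply (u : 𝓢'(ℝ, ℂ)) (φ : 𝓢(ℝ, ℂ)) (t : ℝ) :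
    HasDerivAt (fun t ↦ L t u φ) (-Complex.I * D 1 (L t u) φ) t := by
  have hm : (fun ξ ↦ (japaneseBracket ξ : ℂ)).HasTemperateGrowth :=
    Function.Complex.hasTemperateGrowth_ofReal.comp hasTemperateGrowth_japaneseBracket
  have hpt := hasTemperateGrowth_phase t
  rw [hasDerivAt_iff_tendsto_slope_zero]
  set ψ := SchwartzMap.smulLeftCLM ℂ (phase t) (𝓕⁻ φ) with hψ
  have h1 := tendsto_slope_phase ψ
  have h2 : Continuous fun f : 𝓢(ℝ, ℂ) ↦ u (𝓕 f) :=
    (map_continuous u).comp (FourierTransform.fourierCLM ℂ 𝓢(ℝ, ℂ)).continuous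
  have h3 := (h2.tendsto _).comp h1
  have e0 : ∀ h : ℝ, L (t + h) u φ = u (𝓕 (SchwartzMap.smulLeftCLM ℂ (phase h) ψ)) := by
    intro h
    rw [L_eq, TemperedDistribution.fourierMultiplierCLM_apply_apply, hψ,
      SchwartzMap.smulLeftCLM_smulLeftCLM_apply (hasTemperateGrowth_phase h) hpt, add_comm,
      phase_add]
  have e1 : L t u φ = u (𝓕 ψ) := rfl
  convert! h3 using 2
  · rename_i h
    simp only [Function.comp]
    rw [e0, e1]
    change _ = u (FourierTransform.fourierCLM ℂ 𝓢(ℝ, ℂ) _)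
    rw [← Complex.coe_smul (h⁻¹) (_ : 𝓢(ℝ, ℂ)), map_smul, map_smul, map_sub, map_sub]
    rfl
  · change _ = u (FourierTransform.fourierCLM ℂ 𝓢(ℝ, ℂ) _)
    rw [map_smul, map_smul, smul_eq_mul]
    congr 1
    rw [D_eq, L_eq]
    simp only [TemperedDistribution.fourierMultiplierCLM_apply_apply,
      FourierTransform.fourierInv_fourier_eq, Real.rpow_one]
    rw [SchwartzMap.smulLeftCLM_smulLeftCLM_apply hpt hm, hψ,
      SchwartzMap.smulLeftCLM_smulLeftCLM_apply hm hpt, mul_comm]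
    rfl

/-! ### Compactly supported test functions are dense -/

theorem hasTemperateGrowth_comp_mul {g : ℝ → ℂ} (hg : g.HasTemperateGrowth) (r : ℝ) :
    (fun x ↦ g (r * x)).HasTemperateGrowth := by
  have h : (fun x : ℝ ↦ r * x).HasTemperateGrowth := by fun_prop
  exact hg.comp h

theorem derivCLM_smulLeftCLM_comp_mul {g g' : ℝ → ℂ} (hg : g.HasTemperateGrowth)
    (hg' : g'.HasTemperateGrowth) (hd : ∀ x, HasDerivAt g (g' x) x) (r : ℝ) (ψ : 𝓢(ℝ, ℂ)) :
    SchwartzMap.derivCLM ℝ ℂ (SchwartzMap.smulLeftCLM ℂ (fun x ↦ g (r * x)) ψ) =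
      SchwartzMap.smulLeftCLM ℂ (fun x ↦ g (r * x)) (SchwartzMap.derivCLM ℝ ℂ ψ) +
      r • SchwartzMap.smulLeftCLM ℂ (fun x ↦ g' (r * x)) ψ := by
  have h₁ := hasTemperateGrowth_comp_mul hg r
  have h₂ := hasTemperateGrowth_comp_mul hg' r
  ext x
  have h₃ : HasDerivAt (fun x ↦ g (r * x)) (r • g' (r * x)) x := by
    have := (hd (r * x)).scomp x ((hasDerivAt_id x).const_mul r)
    convert! this using 1
    simp
  have h₄ : HasDerivAt (SchwartzMap.smulLeftCLM ℂ (fun x ↦ g (r * x)) ψ)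
      (r • g' (r * x) * ψ x + g (r * x) * deriv ψ x) x := by
    have := h₃.mul (ψ.hasDerivAt x)
    convert! this using 1
    ext y
    simp [SchwartzMap.smulLeftCLM_apply_apply h₁]
  rw [SchwartzMap.derivCLM_apply, h₄.deriv]
  simp only [add_apply, smul_apply, SchwartzMap.smulLeftCLM_apply_apply h₁,
    SchwartzMap.smulLeftCLM_apply_apply h₂, SchwartzMap.derivCLM_apply, smul_eq_mul,
    Complex.real_smul]
  ring

theorem exists_hasDerivAt_of_hasCompactSupport {g : ℝ → ℂ} (hg : ContDiff ℝ ∞ g)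
    (hc : HasCompactSupport g) : ∃ g' : ℝ → ℂ, ContDiff ℝ ∞ g' ∧ HasCompactSupport g' ∧
      ∀ x, HasDerivAt g (g' x) x :=
  ⟨deriv g, (contDiff_infty_iff_deriv.1 hg).2, hc.deriv,
    fun x ↦ ((hg.differentiable (by simp)) x).hasDerivAt⟩

/-- Uniformity in r is the point: each derivative falling on the cutoff brings out a factor r, which
is at most one in size. -/
theorem exists_seminorm_cutoff_le (n k : ℕ) {g : ℝ → ℂ} (hg : ContDiff ℝ ∞ g)
    (hc : HasCompactSupport g) (ψ : 𝓢(ℝ, ℂ)) :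
    ∃ C, 0 ≤ C ∧ ∀ r : ℝ, |r| ≤ 1 → SchwartzMap.seminorm ℝ k n
      (SchwartzMap.smulLeftCLM ℂ (fun x ↦ g (r * x)) ψ) ≤ C := by
  induction n generalizing ψ g with
  | zero =>
    obtain ⟨M, hM⟩ := hc.exists_bound_of_continuous hg.continuous
    have hM0 : 0 ≤ M := (norm_nonneg _).trans (hM 0)
    refine ⟨M * SchwartzMap.seminorm ℝ k 0 ψ, by positivity, fun r _ ↦ ?_⟩
    refine SchwartzMap.seminorm_le_bound' ℝ _ _ _ (by positivity) fun x ↦ ?_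
    have h1 := SchwartzMap.le_seminorm' ℝ k 0 ψ x
    rw [iteratedDeriv_zero] at h1 ⊢
    rw [SchwartzMap.smulLeftCLM_apply_apply
      (hasTemperateGrowth_comp_mul (hc.hasTemperateGrowth hg) r), norm_smul]
    calc |x| ^ k * (‖g (r * x)‖ * ‖ψ x‖) ≤ |x| ^ k * (M * ‖ψ x‖) := by gcongr; exact hM _
      _ = M * (|x| ^ k * ‖ψ x‖) := by ring
      _ ≤ _ := by gcongr
  | succ n ih =>
    obtain ⟨g', hg', hc', hd⟩ := exists_hasDerivAt_of_hasCompactSupport hg hc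
    obtain ⟨C₁, hC₁, h₁⟩ := ih hg hc (SchwartzMap.derivCLM ℝ ℂ ψ)
    obtain ⟨C₂, hC₂, h₂⟩ := ih hg' hc' ψ
    refine ⟨C₁ + C₂, by positivity, fun r hr ↦ ?_⟩
    rw [seminorm_succ_eq, derivCLM_smulLeftCLM_comp_mul (hc.hasTemperateGrowth hg)
      (hc'.hasTemperateGrowth hg') hd]
    refine (map_add_le_add _ _ _).trans (add_le_add (h₁ r hr) ?_)
    rw [map_smul_eq_mul, Real.norm_eq_abs]
    calc _ ≤ 1 * C₂ := mul_le_mul hr (h₂ r hr) (by positivity) zero_le_one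
      _ = C₂ := one_mul _

theorem exists_seminorm_one_sub_cutoff_le (n k : ℕ) {g : ℝ → ℂ} (hg : ContDiff ℝ ∞ g)
    (hc : HasCompactSupport g) (h1 : ∀ x, |x| ≤ 1 → g x = 1) (ψ : 𝓢(ℝ, ℂ)) :
    ∃ C, 0 ≤ C ∧ ∀ r : ℝ, |r| ≤ 1 → SchwartzMap.seminorm ℝ k n
      (SchwartzMap.smulLeftCLM ℂ (fun x ↦ g (r * x)) ψ - ψ) ≤ C * |r| := by
  have hgt := hc.hasTemperateGrowth hg
  induction n generalizing ψ with
  | zero =>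
    obtain ⟨M, hM⟩ := hc.exists_bound_of_continuous hg.continuous
    have hM0 : 0 ≤ M := (norm_nonneg _).trans (hM 0)
    refine ⟨(M + 1) * SchwartzMap.seminorm ℝ (k + 1) 0 ψ, by positivity, fun r _ ↦ ?_⟩
    refine SchwartzMap.seminorm_le_bound' ℝ _ _ _ (by positivity) fun x ↦ ?_
    have h2 := SchwartzMap.le_seminorm' ℝ (k + 1) 0 ψ x
    rw [iteratedDeriv_zero] at h2 ⊢
    rw [sub_apply, SchwartzMap.smulLeftCLM_apply_apply (hasTemperateGrowth_comp_mul hgt r)]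
    rcases le_total |r * x| 1 with hx | hx
    · rw [h1 _ hx]; simp; positivity
    -- Where the cutoff differs from 1 one has |r||x| ≥ 1, so one extra power of |x| in the seminorm
    -- buys the factor |r|.
    · rw [abs_mul] at hx
      have e : g (r * x) • ψ x - ψ x = (g (r * x) - 1) * ψ x := by rw [smul_eq_mul]; ring
      have hb : ‖g (r * x) - 1‖ ≤ M + 1 := by
        refine (norm_sub_le _ _).trans ?_
        simpa using hM (r * x)
      rw [e, norm_mul]
      calc |x| ^ k * (‖g (r * x) - 1‖ * ‖ψ x‖) ≤ |x| ^ k * ((M + 1) * ‖ψ x‖) := by gcongr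
        _ = (M + 1) * (|x| ^ k * ‖ψ x‖) * 1 := by ring
        _ ≤ (M + 1) * (|x| ^ k * ‖ψ x‖) * (|r| * |x|) := by gcongr
        _ = (M + 1) * (|x| ^ (k + 1) * ‖ψ x‖) * |r| := by ring
        _ ≤ _ := by gcongr
  | succ n ih =>
    obtain ⟨g', hg', hc', hd⟩ := exists_hasDerivAt_of_hasCompactSupport hg hc
    obtain ⟨C₁, hC₁, h₁⟩ := ih (SchwartzMap.derivCLM ℝ ℂ ψ)
    obtain ⟨C₂, hC₂, h₂⟩ := exists_seminorm_cutoff_le n k hg' hc' ψ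
    refine ⟨C₁ + C₂, by positivity, fun r hr ↦ ?_⟩
    rw [seminorm_succ_eq, map_sub, derivCLM_smulLeftCLM_comp_mul hgt
      (hc'.hasTemperateGrowth hg') hd, add_sub_right_comm]
    refine (map_add_le_add _ _ _).trans ?_
    rw [map_smul_eq_mul, Real.norm_eq_abs, add_mul, mul_comm C₂]
    have := h₂ r hr
    exact add_le_add (h₁ r hr) (by gcongr)

/-- Tempered distributions that agree on compactly supported test functions are equal. -/
theorem eq_of_forall_hasCompactSupport {S S' : 𝓢'(ℝ, ℂ)}
    (h : ∀ φ : 𝓢(ℝ, ℂ), HasCompactSupport φ → S φ = S' φ) : S = S' := by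
  ext φ
  let b : ContDiffBump (0 : ℝ) := ⟨1, 2, one_pos, one_lt_two⟩
  set g : ℝ → ℂ := fun x ↦ ((b x : ℝ) : ℂ) with hgdef
  have hg : ContDiff ℝ ∞ g := Complex.ofRealCLM.contDiff.comp b.contDiff
  have hc : HasCompactSupport g := b.hasCompactSupport.comp_left Complex.ofReal_zero
  have h1 : ∀ x, |x| ≤ 1 → g x = 1 := by
    intro x hx
    have : b x = 1 := b.one_of_mem_closedBall (by simpa [Real.dist_eq] using hx)
    simp [hgdef, this]
  have hgt := hc.hasTemperateGrowth hg
  have lim : Tendsto (fun r : ℝ ↦ SchwartzMap.smulLeftCLM ℂ (fun x ↦ g (r * x)) φ)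
      (𝓝[≠] 0) (𝓝 φ) := by
    rw [(schwartz_withSeminorms ℝ ℝ ℂ).tendsto_nhds]
    rintro ⟨k, n⟩ ε hε
    obtain ⟨C, hC, hb⟩ := exists_seminorm_one_sub_cutoff_le n k hg hc h1 φ
    have c1 : Tendsto (fun h : ℝ ↦ |h|) (𝓝 0) (𝓝 0) := by
      simpa using (continuous_abs.tendsto (0 : ℝ))
    have c2 : Tendsto (fun h : ℝ ↦ C * |h|) (𝓝 0) (𝓝 0) := by simpa using c1.const_mul C
    have hev := (c1.eventually_le_const one_pos).and (c2.eventually_lt_const hε)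
    filter_upwards [nhdsWithin_le_nhds hev] with r hr
    exact (hb r hr.1).trans_lt hr.2
  have l₁ := ((map_continuous S).tendsto φ).comp lim
  have l₂ := ((map_continuous S').tendsto φ).comp lim
  refine tendsto_nhds_unique_of_eventuallyEq l₁ l₂ ?_
  filter_upwards [self_mem_nhdsWithin] with r hr
  apply h
  have hr : r ≠ 0 := hr
  have hc' : HasCompactSupport (fun x ↦ g (r * x)) :=
    hc.comp_homeomorph (Homeomorph.mulLeft₀ r hr)
  have e : (SchwartzMap.smulLeftCLM ℂ (fun x ↦ g (r * x)) φ : ℝ → ℂ) =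
      (fun x ↦ g (r * x)) * φ := by
    ext x
    simp [SchwartzMap.smulLeftCLM_apply_apply (hasTemperateGrowth_comp_mul hgt r)]
  rw [e]
  exact hc'.mul_right

/-! ### Distributions that are functions -/

/-- This makes the function representing u(τ), which `IsSolution` only asserts to exist, comparable
with z(τ) + D⁻¹V(τ). -/
theorem IsFunction.ae_eq {S : 𝓢'(ℝ, ℂ)} {f g : ℝ → ℂ} (hf : IsFunction S f)
    (hg : IsFunction S g) : f =ᵐ[volume] g := by
  refine ae_eq_of_integral_contDiff_smul_eq hf.1 hg.1 fun η hη hηc ↦ ?_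
  have hg₁ : HasCompactSupport (Complex.ofRealCLM ∘ η) := hηc.comp_left rfl
  have hg₂ : ContDiff ℝ ∞ (Complex.ofRealCLM ∘ η) := Complex.ofRealCLM.contDiff.comp hη
  have h₁ := hf.2 (hg₁.toSchwartzMap hg₂) hg₁
  have h₂ := hg.2 (hg₁.toSchwartzMap hg₂) hg₁
  rw [h₁] at h₂
  simpa using h₂

theorem IsFunction.eq {S S' : 𝓢'(ℝ, ℂ)} {f f' : ℝ → ℂ} (hf : IsFunction S f)
    (hf' : IsFunction S' f') (h : f =ᵐ[volume] f') : S = S' := by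
  refine eq_of_forall_hasCompactSupport fun φ hφ ↦ ?_
  rw [hf.2 φ hφ, hf'.2 φ hφ]
  refine integral_congr_ae ?_
  filter_upwards [h] with x hx
  rw [hx]

theorem IsFunction.congr {S : 𝓢'(ℝ, ℂ)} {f f' : ℝ → ℂ} (hf : IsFunction S f)
    (h : f =ᵐ[volume] f') : IsFunction S f' := by
  refine ⟨fun x ↦ ?_, fun φ hφ ↦ ?_⟩
  · obtain ⟨s, hs, hi⟩ := hf.1 x
    exact ⟨s, hs, hi.congr (ae_restrict_of_ae h)⟩
  · rw [hf.2 φ hφ]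
    refine integral_congr_ae ?_
    filter_upwards [h] with x hx
    rw [hx]

theorem integrable_schwartz_mul_of_locallyIntegrable {f : ℝ → ℂ} (hf : LocallyIntegrable f volume)
    {φ : 𝓢(ℝ, ℂ)} (hφ : HasCompactSupport φ) : Integrable (fun x ↦ φ x * f x) volume :=
  hf.integrable_smul_left_of_hasCompactSupport φ.continuous hφ

theorem IsFunction.add {S S' : 𝓢'(ℝ, ℂ)} {f f' : ℝ → ℂ} (hf : IsFunction S f)
    (hf' : IsFunction S' f') : IsFunction (S + S') (fun x ↦ f x + f' x) := by
  refine ⟨hf.1.add hf'.1, fun φ hφ ↦ ?_⟩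
  rw [add_apply, hf.2 φ hφ, hf'.2 φ hφ,
    ← integral_add (integrable_schwartz_mul_of_locallyIntegrable hf.1 hφ)
      (integrable_schwartz_mul_of_locallyIntegrable hf'.1 hφ)]
  simp_rw [mul_add]

theorem isFunction_coe_Lp (f : Lp ℂ 2 (volume : Measure ℝ)) : IsFunction (f : 𝓢'(ℝ, ℂ)) f :=
  ⟨(Lp.memLp f).locallyIntegrable (by norm_num), fun φ _ ↦ by simp⟩

theorem coe_Lp_injective {f g : Lp ℂ 2 (volume : Measure ℝ)}
    (h : (f : 𝓢'(ℝ, ℂ)) = (g : 𝓢'(ℝ, ℂ))) : f = g :=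
  LinearMap.ker_eq_bot.1 (Lp.ker_toTemperedDistributionCLM_eq_bot (F := ℂ)
    (μ := (volume : Measure ℝ)) (p := 2)) h

/-! ### Fourier multipliers on `L²` -/

/-- The Hilbert space `L²(ℝ)`. -/
abbrev L2 : Type := Lp ℂ 2 (volume : Measure ℝ)

/-- Multiplication by a bounded continuous function on `L²`. -/
def mulL2 (a : ℝ →ᵇ ℂ) : L2 →L[ℂ] L2 :=
  (ContinuousLinearMap.lsmul ℂ ℂ).holderL volume ∞ 2 2 (a.memLp_top.toLp a)

theorem coeFn_mulL2 (a : ℝ →ᵇ ℂ) (f : L2) : mulL2 a f =ᵐ[volume] fun ξ ↦ a ξ * f ξ := by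
  filter_upwards [(ContinuousLinearMap.lsmul ℂ ℂ).coeFn_holder (r := 2)
    (a.memLp_top.toLp a (μ := (volume : Measure ℝ))) f,
    a.memLp_top.coeFn_toLp (μ := (volume : Measure ℝ))] with ξ h₁ h₂
  change ((ContinuousLinearMap.lsmul ℂ ℂ).holder (r := 2) (a.memLp_top.toLp a) f) ξ = _
  rw [h₁, h₂]; rfl

theorem coe_mulL2 {a : ℝ →ᵇ ℂ} (ha : (a : ℝ → ℂ).HasTemperateGrowth) (f : L2) :
    ((mulL2 a f : L2) : 𝓢'(ℝ, ℂ)) = TemperedDistribution.smulLeftCLM ℂ a f :=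
  Lp.toTemperedDistribution_smul_eq (p := ∞) (q := 2) (r := 2) ha a.memLp_top f

theorem mulL2_mul (a b : ℝ →ᵇ ℂ) (f : L2) : mulL2 a (mulL2 b f) = mulL2 (a * b) f := by
  apply Lp.ext
  filter_upwards [coeFn_mulL2 a (mulL2 b f), coeFn_mulL2 b f, coeFn_mulL2 (a * b) f]
    with ξ h₁ h₂ h₃
  rw [h₁, h₂, h₃, BoundedContinuousFunction.mul_apply]; ring

theorem mulL2_one (f : L2) : mulL2 1 f = f := by
  apply Lp.ext
  filter_upwards [coeFn_mulL2 1 f] with ξ h₁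
  rw [h₁]; simp

theorem norm_mulL2_le (a : ℝ →ᵇ ℂ) {C : ℝ} (hC : ∀ ξ, ‖a ξ‖ ≤ C) (f : L2) :
    ‖mulL2 a f‖ ≤ C * ‖f‖ := by
  refine Lp.norm_le_mul_norm_of_ae_le_mul ?_
  filter_upwards [coeFn_mulL2 a f] with ξ h₁
  rw [h₁, norm_mul]
  gcongr
  exact hC ξ

/-- Dominated convergence. The continuity and differentiability of the flow on L² and the continuity
of point evaluations are all reduced to it. -/
theorem tendsto_mulL2 {ι : Type*} {l : Filter ι} [l.IsCountablyGenerated] {a : ι → ℝ →ᵇ ℂ}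
    {b : ℝ →ᵇ ℂ} {C : ℝ} (hC : ∀ i ξ, ‖a i ξ‖ ≤ C)
    (hlim : ∀ ξ, Tendsto (fun i ↦ a i ξ) l (𝓝 (b ξ))) (f : L2) :
    Tendsto (fun i ↦ mulL2 (a i) f) l (𝓝 (mulL2 b f)) := by
  rw [Lp.tendsto_Lp_iff_tendsto_eLpNorm']
  set M := C + ‖b‖
  have key : ∀ i, eLpNorm ((mulL2 (a i) f : ℝ → ℂ) - (mulL2 b f : ℝ → ℂ)) 2 volume =
      (∫⁻ ξ, ‖(a i ξ - b ξ) * f ξ‖ₑ ^ (2 : ℝ)) ^ (1 / 2 : ℝ) := by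
    intro i
    rw [eLpNorm_eq_lintegral_rpow_enorm_toReal (by norm_num) (by norm_num)]
    simp only [ENNReal.toReal_ofNat]
    congr 1
    refine lintegral_congr_ae ?_
    filter_upwards [coeFn_mulL2 (a i) f, coeFn_mulL2 b f] with ξ h₁ h₂
    rw [Pi.sub_apply, h₁, h₂, sub_mul]
  simp_rw [key]
  have h0 : Tendsto (fun i ↦ ∫⁻ ξ, ‖(a i ξ - b ξ) * f ξ‖ₑ ^ (2 : ℝ)) l
      (𝓝 (∫⁻ _ : ℝ, 0)) := by
    refine tendsto_lintegral_filter_of_dominated_convergence'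
      (fun ξ ↦ (ENNReal.ofReal M * ‖f ξ‖ₑ) ^ (2 : ℝ)) ?_ ?_ ?_ ?_
    · refine Eventually.of_forall fun i ↦ ?_
      have h1 : AEStronglyMeasurable (fun ξ ↦ (a i ξ - b ξ) * f ξ) volume :=
        (((a i).continuous.sub b.continuous).aestronglyMeasurable).mul (Lp.aestronglyMeasurable f)
      exact h1.enorm.pow_const _
    · refine Eventually.of_forall fun i ↦ Eventually.of_forall fun ξ ↦ ?_
      rw [enorm_mul]
      gcongr
      rw [← ofReal_norm]
      apply ENNReal.ofReal_le_ofReal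
      exact (norm_sub_le _ _).trans (add_le_add (hC i ξ) (b.norm_coe_le_norm ξ))
    · simp_rw [ENNReal.mul_rpow_of_nonneg _ _ (zero_le_two)]
      rw [lintegral_const_mul' _ _ (by finiteness)]
      have := (Lp.memLp f).eLpNorm_lt_top
      rw [eLpNorm_lt_top_iff_lintegral_rpow_enorm_lt_top (by norm_num) (by norm_num)] at this
      exact ENNReal.mul_ne_top (by finiteness) (by simpa using this.ne)
    · refine Eventually.of_forall fun ξ ↦ ?_
      have h1 : Tendsto (fun i ↦ (a i ξ - b ξ) * f ξ) l (𝓝 0) := by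
        have := ((hlim ξ).sub_const (b ξ)).mul_const (f ξ)
        simpa using this
      have h2 := (ENNReal.continuous_rpow_const (y := 2)).tendsto _ |>.comp h1.enorm
      simpa [Function.comp_def] using h2
  have h1 := (ENNReal.continuous_rpow_const (y := 1 / 2)).tendsto _ |>.comp h0
  simpa [Function.comp_def] using h1

/-- The Fourier multiplier on `L²` with a bounded continuous symbol. -/
def fourierMul (a : ℝ →ᵇ ℂ) : L2 →L[ℂ] L2 :=
  (FourierTransform.fourierInvCLM ℂ L2).comp ((mulL2 a).comp (FourierTransform.fourierCLM ℂ L2))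

theorem fourierMul_apply (a : ℝ →ᵇ ℂ) (f : L2) : fourierMul a f = 𝓕⁻ (mulL2 a (𝓕 f)) := rfl

theorem norm_fourierInv_L2 (f : L2) : ‖𝓕⁻ f‖ = ‖f‖ := by
  rw [← Lp.norm_fourier_eq (𝓕⁻ f), FourierTransform.fourier_fourierInv_eq]

theorem coe_fourierMul {a : ℝ →ᵇ ℂ} (ha : (a : ℝ → ℂ).HasTemperateGrowth) (f : L2) :
    ((fourierMul a f : L2) : 𝓢'(ℝ, ℂ)) = TemperedDistribution.fourierMultiplierCLM ℂ a f := by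
  rw [fourierMul_apply, ← Lp.fourierInv_toTemperedDistribution_eq, coe_mulL2 ha,
    ← Lp.fourier_toTemperedDistribution_eq, TemperedDistribution.fourierMultiplierCLM_apply]

theorem fourierMul_mul (a b : ℝ →ᵇ ℂ) (f : L2) :
    fourierMul a (fourierMul b f) = fourierMul (a * b) f := by
  simp only [fourierMul_apply, FourierTransform.fourier_fourierInv_eq, mulL2_mul]

theorem fourierMul_one (f : L2) : fourierMul 1 f = f := by
  rw [fourierMul_apply, mulL2_one, FourierTransform.fourierInv_fourier_eq]

theorem norm_fourierMul_le (a : ℝ →ᵇ ℂ) {C : ℝ} (hC : ∀ ξ, ‖a ξ‖ ≤ C) (f : L2) :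
    ‖fourierMul a f‖ ≤ C * ‖f‖ := by
  rw [fourierMul_apply, norm_fourierInv_L2]
  exact (norm_mulL2_le a hC _).trans (by rw [Lp.norm_fourier_eq])

theorem tendsto_fourierMul {ι : Type*} {l : Filter ι} [l.IsCountablyGenerated] {a : ι → ℝ →ᵇ ℂ}
    {b : ℝ →ᵇ ℂ} {C : ℝ} (hC : ∀ i ξ, ‖a i ξ‖ ≤ C)
    (hlim : ∀ ξ, Tendsto (fun i ↦ a i ξ) l (𝓝 (b ξ))) (f : L2) :
    Tendsto (fun i ↦ fourierMul (a i) f) l (𝓝 (fourierMul b f)) :=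
  ((FourierTransform.fourierInvCLM ℂ L2).continuous.tendsto _).comp (tendsto_mulL2 hC hlim _)

theorem inner_mulL2_self_im {a : ℝ →ᵇ ℂ} (ha : ∀ ξ, (a ξ).im = 0) (f : L2) :
    (⟪mulL2 a f, f⟫_ℂ).im = 0 := by
  rw [← Complex.conj_eq_iff_im, inner_conj_symm, L2.inner_def, L2.inner_def]
  refine integral_congr_ae ?_
  filter_upwards [coeFn_mulL2 a f] with ξ h
  rw [h]
  have := Complex.conj_eq_iff_im.2 (ha ξ)
  simp only [RCLike.inner_apply, map_mul, this]
  ring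

/-- A real symbol gives a symmetric operator; this drives the conservation law behind the uniqueness
of mild representations. -/
theorem inner_fourierMul_self_im {a : ℝ →ᵇ ℂ} (ha : ∀ ξ, (a ξ).im = 0) (f : L2) :
    (⟪fourierMul a f, f⟫_ℂ).im = 0 := by
  rw [← Lp.inner_fourier_eq, fourierMul_apply, FourierTransform.fourier_fourierInv_eq]
  exact inner_mulL2_self_im ha _

/-! ### The linear flow and `(1 - Δ)^{-1/2}` on `L²` -/

/-- The symbol of the linear flow as a bounded continuous function. -/
def phaseBCF (t : ℝ) : ℝ →ᵇ ℂ :=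
  BoundedContinuousFunction.ofNormedAddCommGroup (phase t)
    (hasTemperateGrowth_phase t).1.continuous 1 fun ξ ↦ (norm_phase t ξ).le

@[simp]
theorem phaseBCF_apply (t ξ : ℝ) : phaseBCF t ξ = phase t ξ := rfl

theorem rpow_neg_one_japaneseBracket_le_one (ξ : ℝ) : japaneseBracket ξ ^ (-1 : ℝ) ≤ 1 := by
  rw [Real.rpow_neg_one]
  exact inv_le_one_of_one_le₀ (one_le_japaneseBracket ξ)

theorem norm_ofReal_japaneseBracket_neg_one_le (ξ : ℝ) :
    ‖((japaneseBracket ξ ^ (-1 : ℝ) : ℝ) : ℂ)‖ ≤ 1 := by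
  have := japaneseBracket_pos ξ
  rw [Complex.norm_real, Real.norm_eq_abs, abs_of_nonneg (by positivity)]
  exact rpow_neg_one_japaneseBracket_le_one ξ

/-- The symbol of `(1 - Δ)^{-1/2}` as a bounded continuous function. -/
def besselBCF : ℝ →ᵇ ℂ :=
  BoundedContinuousFunction.ofNormedAddCommGroup
    (fun ξ ↦ ((japaneseBracket ξ ^ (-1 : ℝ) : ℝ) : ℂ))
    (hasTemperateGrowth_ofReal_japaneseBracket_rpow (-1)).1.continuous 1
    norm_ofReal_japaneseBracket_neg_one_le

theorem besselBCF_apply (ξ : ℝ) : besselBCF ξ = ((japaneseBracket ξ ^ (-1 : ℝ) : ℝ) : ℂ) := rfl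

/-- The linear flow on `L²`. -/
def flow (t : ℝ) : L2 →L[ℂ] L2 := fourierMul (phaseBCF t)

/-- The operator `(1 - Δ)^{-1/2}` on `L²`. -/
def bessel : L2 →L[ℂ] L2 := fourierMul besselBCF

theorem coe_bessel (f : L2) : ((bessel f : L2) : 𝓢'(ℝ, ℂ)) = D (-1) f :=
  coe_fourierMul (hasTemperateGrowth_ofReal_japaneseBracket_rpow (-1)) f

theorem flow_flow (s t : ℝ) (f : L2) : flow s (flow t f) = flow (s + t) f := by
  rw [flow, flow, flow, fourierMul_mul]
  congr 2
  ext ξ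
  simp [phase_add]

theorem flow_zero (f : L2) : flow 0 f = f := by
  rw [flow]
  convert fourierMul_one f using 3
  ext ξ
  simp

theorem norm_flow (t : ℝ) (f : L2) : ‖flow t f‖ = ‖f‖ := by
  have h : ∀ (t : ℝ) (f : L2), ‖flow t f‖ ≤ ‖f‖ := fun t f ↦ by
    simpa [flow] using norm_fourierMul_le (phaseBCF t) (C := 1) (fun ξ ↦ (norm_phase t ξ).le) f
  refine le_antisymm (h t f) ?_
  have := h (-t) (flow t f)
  rwa [flow_flow, neg_add_cancel, flow_zero] at this

theorem continuous_flow_apply (f : L2) : Continuous fun t ↦ flow t f := by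
  rw [continuous_iff_continuousAt]
  intro t
  refine tendsto_fourierMul (C := 1) (fun s ξ ↦ (norm_phase s ξ).le) (fun ξ ↦ ?_) f
  exact (hasDerivAt_phase_time t ξ).continuousAt

/-- Strong continuity upgrades to joint continuity because every L(t) is an isometry. -/
theorem continuous_flow : Continuous fun p : ℝ × L2 ↦ flow p.1 p.2 := by
  rw [continuous_iff_continuousAt]
  rintro ⟨t, f⟩
  have h1 : Tendsto (fun p : ℝ × L2 ↦ flow p.1 f) (𝓝 (t, f)) (𝓝 (flow t f)) :=
    ((continuous_flow_apply f).comp continuous_fst).tendsto (t, f)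
  have h2 : Tendsto (fun p : ℝ × L2 ↦ flow p.1 (p.2 - f)) (𝓝 (t, f)) (𝓝 0) := by
    rw [tendsto_zero_iff_norm_tendsto_zero]
    simp_rw [norm_flow]
    have : Tendsto (fun p : ℝ × L2 ↦ ‖p.2 - f‖) (𝓝 (t, f)) (𝓝 ‖f - f‖) :=
      ((continuous_snd.sub continuous_const).norm).tendsto (t, f)
    simpa using this
  have h3 := h1.add h2
  simpa [ContinuousAt] using h3

theorem bessel_injective {f : L2} (h : bessel f = 0) : f = 0 := by
  apply coe_Lp_injective
  have h1 := coe_bessel f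
  rw [h] at h1
  rw [← D_one_D_neg_one (f : 𝓢'(ℝ, ℂ)), ← h1]
  have h0 : ((0 : L2) : 𝓢'(ℝ, ℂ)) = 0 := map_zero (Lp.toTemperedDistributionCLM ℂ volume 2)
  rw [h0, map_zero]

theorem inner_bessel_self_im (f : L2) : (⟪bessel f, f⟫_ℂ).im = 0 :=
  inner_fourierMul_self_im (fun ξ ↦ by rw [besselBCF_apply, Complex.ofReal_im]) f

theorem norm_phase_sub_one_le (h ξ : ℝ) : ‖phase h ξ - 1‖ ≤ |h| * japaneseBracket ξ := by
  have e : phase h ξ = Complex.exp (Complex.I * ((-(h * japaneseBracket ξ) : ℝ) : ℂ)) := by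
    rw [phase]; congr 1; push_cast; ring
  rw [e]
  refine Real.norm_exp_I_mul_ofReal_sub_one_le.trans ?_
  rw [Real.norm_eq_abs, abs_neg, abs_mul, abs_of_pos (japaneseBracket_pos ξ)]

theorem fourierMul_sub (a b : ℝ →ᵇ ℂ) (f : L2) :
    fourierMul (a - b) f = fourierMul a f - fourierMul b f := by
  have : mulL2 (a - b) (𝓕 f) = mulL2 a (𝓕 f) - mulL2 b (𝓕 f) := by
    apply Lp.ext
    filter_upwards [coeFn_mulL2 (a - b) (𝓕 f), coeFn_mulL2 a (𝓕 f), coeFn_mulL2 b (𝓕 f),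
      Lp.coeFn_sub (mulL2 a (𝓕 f)) (mulL2 b (𝓕 f))] with ξ h₁ h₂ h₃ h₄
    rw [h₁, h₄, Pi.sub_apply, h₂, h₃, BoundedContinuousFunction.sub_apply, sub_mul]
  rw [fourierMul_apply, this]
  exact map_sub (FourierTransform.fourierInvCLM ℂ L2) _ _

theorem fourierMul_smul (c : ℂ) (b : ℝ →ᵇ ℂ) (f : L2) :
    fourierMul (c • b) f = c • fourierMul b f := by
  have : mulL2 (c • b) (𝓕 f) = c • mulL2 b (𝓕 f) := by
    apply Lp.ext
    filter_upwards [coeFn_mulL2 (c • b) (𝓕 f), coeFn_mulL2 b (𝓕 f),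
      Lp.coeFn_smul c (mulL2 b (𝓕 f))] with ξ h₁ h₂ h₃
    rw [h₁, h₃, Pi.smul_apply, h₂]
    simp [mul_assoc]
  rw [fourierMul_apply, this]
  exact map_smul (FourierTransform.fourierInvCLM ℂ L2) _ _

/-- For general f in L² the flow need not be differentiable in L². After D⁻¹ the difference
quotients of the symbol are bounded by ⟨ξ⟩⁻¹⟨ξ⟩ = 1, so they converge strongly. -/
theorem hasDerivAt_bessel_flow (f : L2) (t : ℝ) :
    HasDerivAt (fun t ↦ bessel (flow t f)) (-Complex.I • flow t f) t := by
  rw [hasDerivAt_iff_tendsto_slope_zero]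
  have e : ∀ h : ℝ, h⁻¹ • (bessel (flow (t + h) f) - bessel (flow t f)) =
      fourierMul (((h⁻¹ : ℝ) : ℂ) • (besselBCF * phaseBCF (t + h) - besselBCF * phaseBCF t)) f := by
    intro h
    rw [fourierMul_smul, fourierMul_sub, ← fourierMul_mul, ← fourierMul_mul]
    rfl
  have e' : -Complex.I • flow t f = fourierMul (-Complex.I • phaseBCF t) f := by
    rw [fourierMul_smul]; rfl
  simp_rw [e, e']
  have hval : ∀ h ξ : ℝ, (((h⁻¹ : ℝ) : ℂ) •
      (besselBCF * phaseBCF (t + h) - besselBCF * phaseBCF t)) ξ =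
      besselBCF ξ * (((h⁻¹ : ℝ) : ℂ) * (phase (t + h) ξ - phase t ξ)) := by
    intro h ξ
    simp only [BoundedContinuousFunction.coe_smul, BoundedContinuousFunction.sub_apply,
      BoundedContinuousFunction.mul_apply, phaseBCF_apply, smul_eq_mul]
    ring
  refine tendsto_fourierMul (C := 1) (fun h ξ ↦ ?_) (fun ξ ↦ ?_) f
  · rw [hval, phase_add, Pi.mul_apply]
    have e3 : phase t ξ * phase h ξ - phase t ξ = phase t ξ * (phase h ξ - 1) := by ring
    have hpos := japaneseBracket_pos ξ
    rw [e3, norm_mul, norm_mul, norm_mul, norm_phase, besselBCF_apply, Complex.norm_real,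
      Complex.norm_real, Real.norm_eq_abs, abs_of_nonneg (by positivity), Real.rpow_neg_one,
      norm_inv, Real.norm_eq_abs, one_mul]
    calc (japaneseBracket ξ)⁻¹ * (|h|⁻¹ * ‖phase h ξ - 1‖)
        ≤ (japaneseBracket ξ)⁻¹ * (|h|⁻¹ * (|h| * japaneseBracket ξ)) := by
          gcongr; exact norm_phase_sub_one_le h ξ
      _ = (|h|⁻¹ * |h|) * ((japaneseBracket ξ)⁻¹ * japaneseBracket ξ) := by ring
      _ ≤ 1 * 1 := by
          gcongr
          · exact inv_mul_le_one
          · exact inv_mul_le_one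
      _ = 1 := one_mul 1
  · simp_rw [hval]
    have h1 := (hasDerivAt_iff_tendsto_slope_zero.1 (hasDerivAt_phase_time t ξ)).const_mul
      (besselBCF ξ)
    have hne : (japaneseBracket ξ : ℂ) ≠ 0 := by exact_mod_cast (japaneseBracket_pos ξ).ne'
    convert! h1 using 2
    rw [besselBCF_apply, Real.rpow_neg_one]
    simp only [BoundedContinuousFunction.coe_smul, phaseBCF_apply, smul_eq_mul,
      Complex.ofReal_inv]
    field_simp

/-! ### The embedding of `H¹` into bounded continuous functions -/

/-- This is the Sobolev embedding of H¹ into bounded functions in dimension one: D⁻¹G is evaluated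
by pairing with modulated copies of this function. -/
theorem memLp_bessel :
    MemLp (fun ξ ↦ ((japaneseBracket ξ ^ (-1 : ℝ) : ℝ) : ℂ)) 2 (volume : Measure ℝ) := by
  rw [memLp_two_iff_integrable_sq_norm
    (hasTemperateGrowth_ofReal_japaneseBracket_rpow (-1)).1.continuous.aestronglyMeasurable]
  have h := integrable_inv_one_add_sq.comp_mul_left' (R := 2 * Real.pi) (by positivity)
  convert! h using 1
  ext ξ
  rw [Complex.norm_real, Real.norm_eq_abs, sq_abs, Real.rpow_neg_one, inv_pow, japaneseBracket_sq]

/-- The symbol of `(1 - Δ)^{-1/2}` as an element of `L²`. -/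
def besselL2 : L2 := memLp_bessel.toLp _

/-- The character `ξ ↦ exp (-2πi x ξ)`. -/
def charBCF (x : ℝ) : ℝ →ᵇ ℂ :=
  BoundedContinuousFunction.ofNormedAddCommGroup (fun ξ ↦ ((𝐞 (-(ξ * x)) : Circle) : ℂ))
    (by fun_prop) 1 fun ξ ↦ (Circle.norm_coe _).le

/-- The element of `L²` whose inner product with `G` is the value of `(1 - Δ)^{-1/2} G` at `x`. -/
def evalKernel (x : ℝ) : L2 := 𝓕⁻ (mulL2 (charBCF x) besselL2)

/-- The value at `x` of the continuous function `(1 - Δ)^{-1/2} G`. -/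
def besselFun (G : L2) (x : ℝ) : ℂ := ⟪evalKernel x, G⟫_ℂ

theorem continuous_evalKernel : Continuous evalKernel := by
  refine (FourierTransform.fourierInvCLM ℂ L2).continuous.comp ?_
  rw [continuous_iff_continuousAt]
  intro x
  refine tendsto_mulL2 (C := 1) (fun y ξ ↦ (Circle.norm_coe _).le) (fun ξ ↦ ?_) _
  have : Continuous fun y : ℝ ↦ ((𝐞 (-(ξ * y)) : Circle) : ℂ) := by fun_prop
  exact this.tendsto x

theorem norm_evalKernel_le (x : ℝ) : ‖evalKernel x‖ ≤ ‖besselL2‖ := by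
  rw [evalKernel, norm_fourierInv_L2]
  simpa using norm_mulL2_le (charBCF x) (C := 1) (fun ξ ↦ (Circle.norm_coe _).le) besselL2

theorem norm_besselFun_le (G : L2) (x : ℝ) : ‖besselFun G x‖ ≤ ‖besselL2‖ * ‖G‖ :=
  (norm_inner_le_norm _ _).trans (by gcongr; exact norm_evalKernel_le x)

theorem continuous_besselFun (G : L2) : Continuous (besselFun G) :=
  continuous_evalKernel.inner continuous_const

theorem besselFun_sub (G H : L2) (x : ℝ) :
    besselFun (G - H) x = besselFun G x - besselFun H x := inner_sub_right _ _ _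

theorem integrable_bessel_mul (F : L2) :
    Integrable (fun ξ ↦ ((japaneseBracket ξ ^ (-1 : ℝ) : ℝ) : ℂ) * F ξ) volume :=
  memLp_bessel.integrable_mul (Lp.memLp F)

theorem besselFun_eq_fourierInv (G : L2) (x : ℝ) :
    besselFun G x =
      𝓕⁻ (fun ξ ↦ ((japaneseBracket ξ ^ (-1 : ℝ) : ℝ) : ℂ) * (𝓕 G : L2) ξ) x := by
  rw [besselFun, ← Lp.inner_fourier_eq, evalKernel, FourierTransform.fourier_fourierInv_eq,
    L2.inner_def, Real.fourierInv_eq]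
  refine integral_congr_ae ?_
  filter_upwards [coeFn_mulL2 (charBCF x) besselL2, memLp_bessel.coeFn_toLp] with ξ h₁ h₂
  have h₂' : besselL2 ξ = ((japaneseBracket ξ ^ (-1 : ℝ) : ℝ) : ℂ) := h₂
  have h₃ : conj (charBCF x ξ) = ((𝐞 (inner ℝ ξ x) : Circle) : ℂ) := by
    change conj ((𝐞 (-(ξ * x)) : Circle) : ℂ) = _
    rw [← Circle.coe_inv_eq_conj, ← AddChar.map_neg_eq_inv, neg_neg]
    congr 2
    simp [mul_comm]
  rw [h₁, h₂', RCLike.inner_apply, map_mul, h₃, Complex.conj_ofReal, Circle.smul_def, smul_eq_mul]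
  ring

theorem integral_fourierInv_mul_eq {f g : ℝ → ℂ} (hf : Integrable f) (hg : Integrable g) :
    ∫ ξ, 𝓕⁻ f ξ * g ξ = ∫ x, f x * 𝓕⁻ g x := by
  -- The inverse transform is the Fourier integral for minus the inner product. That pairing is
  -- symmetric, so flipping it changes nothing.
  have h := VectorFourier.integral_fourierIntegral_smul_eq_flip (L := -innerₗ ℝ)
    (μ := (volume : Measure ℝ)) (ν := (volume : Measure ℝ)) (f := f) (g := g)
    Real.continuous_fourierChar (by
      have : Continuous fun p : ℝ × ℝ ↦ -(inner ℝ p.1 p.2 : ℝ) := by fun_prop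
      exact this) hf hg
  have e : (-innerₗ ℝ : ℝ →ₗ[ℝ] ℝ →ₗ[ℝ] ℝ).flip = -innerₗ ℝ := by
    ext
    simp
  rw [e] at h
  simpa only [smul_eq_mul] using! h

/-- The inverse transform moves from φ onto ⟨ξ⟩⁻¹Ĝ, which is integrable as a product of two L²
functions. -/
theorem D_neg_one_apply_eq (G : L2) (φ : 𝓢(ℝ, ℂ)) :
    D (-1) (G : 𝓢'(ℝ, ℂ)) φ = ∫ x, φ x * besselFun G x := by
  have hm := hasTemperateGrowth_ofReal_japaneseBracket_rpow (-1)
  have h1 : D (-1) (G : 𝓢'(ℝ, ℂ)) φ = TemperedDistribution.smulLeftCLM ℂ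
      (fun ξ ↦ ((japaneseBracket ξ ^ (-1 : ℝ) : ℝ) : ℂ)) (𝓕 (G : 𝓢'(ℝ, ℂ))) (𝓕⁻ φ) := rfl
  rw [h1, Lp.fourier_toTemperedDistribution_eq, TemperedDistribution.smulLeftCLM_apply_apply,
    Lp.toTemperedDistribution_apply]
  have h2 := integral_fourierInv_mul_eq φ.integrable (integrable_bessel_mul (𝓕 G : L2))
  simp_rw [besselFun_eq_fourierInv, ← h2]
  refine integral_congr_ae (Eventually.of_forall fun ξ ↦ ?_)
  have h3 : (𝓕⁻ φ : 𝓢(ℝ, ℂ)) ξ = 𝓕⁻ (φ : ℝ → ℂ) ξ := by rw [SchwartzMap.fourierInv_coe]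
  simp only [SchwartzMap.smulLeftCLM_apply_apply hm, h3, smul_eq_mul]
  ring

theorem isFunction_D_neg_one (G : L2) : IsFunction (D (-1) (G : 𝓢'(ℝ, ℂ))) (besselFun G) :=
  ⟨(continuous_besselFun G).locallyIntegrable, fun φ _ ↦ D_neg_one_apply_eq G φ⟩

/-! ### Measurability of `L²`-valued maps -/

theorem measurable_eLpNorm_two {E : Type*} [NormedAddCommGroup E] [MeasurableSpace E]
    [OpensMeasurableSpace E] {F : ℝ → ℝ → E}
    (hF : Measurable (Function.uncurry F)) : Measurable fun τ ↦ eLpNorm (F τ) 2 volume := by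
  have : (fun τ ↦ eLpNorm (F τ) 2 volume) =
      fun τ ↦ (∫⁻ x, ‖F τ x‖ₑ ^ (2 : ℝ)) ^ (1 / 2 : ℝ) := by
    ext τ
    rw [eLpNorm_eq_lintegral_rpow_enorm_toReal (by norm_num) (by norm_num)]
    simp
  rw [this]
  have h : Measurable (Function.uncurry fun τ x ↦ ‖F τ x‖ₑ ^ (2 : ℝ)) := hF.enorm.pow_const _
  exact h.lintegral_prod_right'.pow_const _

theorem stronglyMeasurable_of_ae_eq {h : ℝ → L2} {F : ℝ → ℝ → ℂ}
    (hF : Measurable (Function.uncurry F)) (hh : ∀ τ, h τ =ᵐ[volume] F τ) :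
    StronglyMeasurable h := by
  borelize L2
  -- A finite exponent makes L² separable. Every open set is then a countable union of balls, so
  -- measurability of the distances to fixed points, which Tonelli provides, is enough.
  have : Fact ((2 : ℝ≥0∞) ≠ ⊤) := ⟨by norm_num⟩
  have hdist : ∀ g : L2, Measurable fun τ ↦ edist (h τ) g := by
    intro g
    obtain ⟨g', hg', hgg'⟩ := Lp.aestronglyMeasurable g
    have e : (fun τ ↦ edist (h τ) g) = fun τ ↦ eLpNorm (F τ - g') 2 volume := by
      ext τ
      rw [Lp.edist_def]
      exact eLpNorm_congr_ae ((hh τ).sub hgg')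
    rw [e]
    have hm : Measurable (Function.uncurry fun τ x ↦ F τ x - g' x) :=
      hF.sub (hg'.measurable.comp measurable_snd)
    exact measurable_eLpNorm_two hm
  refine Measurable.stronglyMeasurable (measurable_of_isOpen fun O hO ↦ ?_)
  have hex : ∀ x : O, ∃ r : ℝ≥0∞, 0 < r ∧ Metric.eball (x : L2) r ⊆ O := fun x ↦
    EMetric.isOpen_iff.1 hO x x.2
  choose r hr hrO using hex
  obtain ⟨c, hc, hcU⟩ := TopologicalSpace.isOpen_iUnion_countable
    (fun x : O ↦ Metric.eball (x : L2) (r x)) (fun x ↦ Metric.isOpen_eball)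
  have hOU : O = ⋃ x ∈ c, Metric.eball (x : L2) (r x) := by
    rw [hcU]
    apply Subset.antisymm
    · intro y hy
      exact mem_iUnion.2 ⟨⟨y, hy⟩, Metric.mem_eball_self (hr ⟨y, hy⟩)⟩
    · exact iUnion_subset hrO
  rw [hOU, preimage_iUnion₂]
  refine MeasurableSet.biUnion hc fun x _ ↦ ?_
  exact measurableSet_lt (hdist x) measurable_const

/-! ### The nonlinearity -/

/-- The nonlinearity `χ (Re f)³`. -/
def cubic (χ : ℝ → ℝ) (f : ℝ → ℂ) (x : ℝ) : ℂ := ((χ x * (f x).re ^ 3 : ℝ) : ℂ)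

open Classical in
/-- The nonlinearity `χ (Re (w + (1 - Δ)^{-1/2} V))³` as an element of `L²`. -/
def source (χ : ℝ → ℝ) (w : ℝ → ℂ) (V : L2) : L2 :=
  if h : MemLp (cubic χ fun x ↦ w x + besselFun V x) 2 volume then h.toLp _ else 0

theorem source_ae_eq {χ : ℝ → ℝ} {w : ℝ → ℂ} {V : L2}
    (h : MemLp (cubic χ fun x ↦ w x + besselFun V x) 2 volume) :
    source χ w V =ᵐ[volume] cubic χ fun x ↦ w x + besselFun V x := by
  rw [source, dif_pos h]
  exact h.coeFn_toLp

theorem measurable_cubic_uncurry {χ : ℝ → ℝ} (hχ : Measurable χ) {f : ℝ → ℝ → ℂ}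
    (hf : Measurable (Function.uncurry f)) :
    Measurable (Function.uncurry fun τ ↦ cubic χ (f τ)) :=
  Complex.measurable_ofReal.comp
    ((hχ.comp measurable_snd).mul ((Complex.measurable_re.comp hf).pow_const 3))

theorem measurable_cubic {χ : ℝ → ℝ} (hχ : Measurable χ) {f : ℝ → ℂ} (hf : Measurable f) :
    Measurable (cubic χ f) :=
  Complex.measurable_ofReal.comp (hχ.mul ((Complex.measurable_re.comp hf).pow_const 3))

theorem stronglyMeasurable_source {χ : ℝ → ℝ} (hχ : Measurable χ) {z : ℝ → ℝ → ℂ}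
    (hz : Measurable (Function.uncurry z)) {V : ℝ → L2} (hV : Continuous V) :
    StronglyMeasurable fun τ ↦ source χ (z τ) (V τ) := by
  set f : ℝ → ℝ → ℂ := fun τ x ↦ z τ x + besselFun (V τ) x with hf
  have hfm : Measurable (Function.uncurry f) := by
    refine hz.add ?_
    have : Continuous fun p : ℝ × ℝ ↦ besselFun (V p.1) p.2 :=
      (continuous_evalKernel.comp continuous_snd).inner (hV.comp continuous_fst)
    exact this.measurable
  have hcm := measurable_cubic_uncurry hχ hfm
  -- Off `s` the value of `source` is its default 0, so cutting the joint representative off to `s`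
  -- matches it at every time.
  set s : Set ℝ := {τ | eLpNorm (cubic χ (f τ)) 2 volume < ⊤} with hs
  have hsm : MeasurableSet s := measurableSet_lt (measurable_eLpNorm_two hcm) measurable_const
  refine stronglyMeasurable_of_ae_eq
    (F := fun τ x ↦ (s ×ˢ univ).indicator (Function.uncurry fun τ ↦ cubic χ (f τ)) (τ, x))
    (hcm.indicator (hsm.prod MeasurableSet.univ)) fun τ ↦ ?_
  have hmτ : Measurable (cubic χ (f τ)) := hcm.comp measurable_prodMk_left
  by_cases hτ : τ ∈ s
  · have hmem : MemLp (cubic χ (f τ)) 2 volume := ⟨hmτ.aestronglyMeasurable, hτ⟩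
    filter_upwards [source_ae_eq hmem] with x hx
    rw [hx, indicator_of_mem (by simp [hτ])]
    rfl
  · have hmem : ¬ MemLp (cubic χ (f τ)) 2 volume := fun h ↦ hτ h.2
    rw [source, dif_neg hmem]
    filter_upwards [Lp.coeFn_zero ℂ 2 (volume : Measure ℝ)] with x hx
    rw [hx, indicator_of_notMem (by simp [hτ])]
    rfl

theorem eLpNorm_two_le_of_le {f : ℝ → ℂ} {p q : ℝ → ℝ} (hp : AEStronglyMeasurable p volume)
    (hq : AEStronglyMeasurable q volume) {c d : ℝ}
    (h : ∀ᵐ x, ‖f x‖ ≤ c * p x + d * q x) :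
    eLpNorm f 2 volume ≤ ‖c‖ₑ * eLpNorm p 2 volume + ‖d‖ₑ * eLpNorm q 2 volume := by
  calc eLpNorm f 2 volume ≤ eLpNorm (c • p + d • q) 2 volume :=
        eLpNorm_mono_ae_real h
    _ ≤ eLpNorm (c • p) 2 volume + eLpNorm (d • q) 2 volume :=
        eLpNorm_add_le (hp.const_smul c) (hq.const_smul d) (by norm_num)
    _ = _ := by rw [eLpNorm_const_smul, eLpNorm_const_smul]

theorem norm_le_of_ae_le {f : L2} {p q : ℝ → ℝ} (hp : MemLp p 2 volume)
    (hq : MemLp q 2 volume) {c d : ℝ} (hc : 0 ≤ c) (hd : 0 ≤ d)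
    (h : ∀ᵐ x, ‖f x‖ ≤ c * p x + d * q x) :
    ‖f‖ ≤ c * (eLpNorm p 2 volume).toReal + d * (eLpNorm q 2 volume).toReal := by
  have h1 := eLpNorm_two_le_of_le hp.1 hq.1 h
  have ep := hp.2.ne
  have eq := hq.2.ne
  rw [Lp.norm_def]
  refine (ENNReal.toReal_mono (by finiteness) h1).trans (le_of_eq ?_)
  rw [ENNReal.toReal_add (by finiteness) (by finiteness), ENNReal.toReal_mul, ENNReal.toReal_mul]
  simp [abs_of_nonneg hc, abs_of_nonneg hd]

/-! ### L² bounds and Lipschitz estimates for the cubic term at a fixed time -/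

section Bounds

variable {χ : ℝ → ℝ} (hχ : Measurable χ) (hχ0 : ∀ x, 0 ≤ χ x) (hχ2 : MemLp χ 2 volume)
  {w : ℝ → ℂ} (hw : Measurable w) (hb : MemLp (fun x ↦ χ x * ‖w x‖ ^ 3) 2 volume)

include hχ0 in
theorem norm_cubic_le (V : L2) (x : ℝ) :
    ‖cubic χ (fun x ↦ w x + besselFun V x) x‖ ≤
      4 * (χ x * ‖w x‖ ^ 3) + 4 * (‖besselL2‖ * ‖V‖) ^ 3 * χ x := by
  have h1 : |(w x + besselFun V x).re| ≤ ‖w x‖ + ‖besselL2‖ * ‖V‖ :=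
    (Complex.abs_re_le_norm _).trans
      ((norm_add_le _ _).trans (by gcongr; exact norm_besselFun_le V x))
  have ha := norm_nonneg (w x)
  have hc : 0 ≤ ‖besselL2‖ * ‖V‖ := by positivity
  set a := ‖w x‖
  set c := ‖besselL2‖ * ‖V‖
  rw [cubic, Complex.norm_real, norm_mul, Real.norm_eq_abs, abs_of_nonneg (hχ0 x), norm_pow,
    Real.norm_eq_abs]
  -- Convexity of the cube; the difference of the two sides is 3(a + c)(a - c)².
  have h2 : (a + c) ^ 3 ≤ 4 * (a ^ 3 + c ^ 3) := by
    nlinarith [mul_nonneg (add_nonneg ha hc) (sq_nonneg (a - c))]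
  calc χ x * |(w x + besselFun V x).re| ^ 3 ≤ χ x * (4 * (a ^ 3 + c ^ 3)) := by
        have := hχ0 x
        gcongr
        exact (pow_le_pow_left₀ (abs_nonneg _) h1 3).trans h2
    _ = _ := by ring

include hχ hχ0 hχ2 hw hb in
theorem memLp_cubic (V : L2) : MemLp (cubic χ fun x ↦ w x + besselFun V x) 2 volume := by
  have hm : Measurable (cubic χ fun x ↦ w x + besselFun V x) :=
    measurable_cubic hχ (hw.add (continuous_besselFun V).measurable)
  refine ⟨hm.aestronglyMeasurable, ?_⟩
  refine (eLpNorm_two_le_of_le hb.1 hχ2.1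
    (Eventually.of_forall (norm_cubic_le hχ0 V))).trans_lt ?_
  have e1 := hb.2.ne
  have e2 := hχ2.2.ne
  finiteness

include hχ hχ0 hχ2 hw hb in
theorem norm_source_le (V : L2) :
    ‖source χ w V‖ ≤ 4 * (eLpNorm (fun x ↦ χ x * ‖w x‖ ^ 3) 2 volume).toReal +
      4 * (‖besselL2‖ * ‖V‖) ^ 3 * (eLpNorm χ 2 volume).toReal := by
  refine norm_le_of_ae_le hb hχ2 (by norm_num) (by positivity) ?_
  filter_upwards [source_ae_eq (memLp_cubic hχ hχ0 hχ2 hw hb V)] with x hx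
  rw [hx]
  exact norm_cubic_le hχ0 V x

theorem abs_cube_sub_cube_le (a b : ℝ) : |a ^ 3 - b ^ 3| ≤ 3 / 2 * |a - b| * (a ^ 2 + b ^ 2) := by
  have e : a ^ 3 - b ^ 3 = (a - b) * (a ^ 2 + a * b + b ^ 2) := by ring
  have h : |a ^ 2 + a * b + b ^ 2| ≤ 3 / 2 * (a ^ 2 + b ^ 2) := by
    rw [abs_le]; constructor <;> nlinarith [sq_nonneg (a - b), sq_nonneg (a + b)]
  rw [e, abs_mul]
  nlinarith [abs_nonneg (a - b), mul_le_mul_of_nonneg_left h (abs_nonneg (a - b))]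

/-- The Lipschitz estimate produces χ|w|², whereas the controlled quantities are χ and χ|w|³. The
threshold μ is kept free, to be tuned to Λ and ε at the end. -/
theorem sq_le_add_cube_div {a μ : ℝ} (ha : 0 ≤ a) (hμ : 0 < μ) : a ^ 2 ≤ μ ^ 2 + a ^ 3 / μ := by
  rcases le_total a μ with h | h
  · have : 0 ≤ a ^ 3 / μ := by positivity
    nlinarith
  · have : a ^ 2 ≤ a ^ 3 / μ := by
      rw [le_div_iff₀ hμ]
      nlinarith [sq_nonneg a]
    nlinarith [sq_nonneg μ]

include hχ0 in
theorem norm_cubic_sub_le (V W : L2) {μ : ℝ} (hμ : 0 < μ) (x : ℝ) :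
    ‖cubic χ (fun x ↦ w x + besselFun V x) x - cubic χ (fun x ↦ w x + besselFun W x) x‖ ≤
      (‖besselL2‖ * ‖V - W‖ * (6 / μ)) * (χ x * ‖w x‖ ^ 3) +
      (‖besselL2‖ * ‖V - W‖ *
        (6 * μ ^ 2 + 3 * ‖besselL2‖ ^ 2 * (‖V‖ ^ 2 + ‖W‖ ^ 2))) * χ x := by
  set κ := ‖besselL2‖ with hκ
  have hκ0 : 0 ≤ κ := norm_nonneg _
  have hre : ∀ G : L2, (w x + besselFun G x).re ^ 2 ≤ 2 * ‖w x‖ ^ 2 + 2 * (κ * ‖G‖) ^ 2 := by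
    intro G
    have h1 : |(w x + besselFun G x).re| ≤ ‖w x‖ + κ * ‖G‖ :=
      (Complex.abs_re_le_norm _).trans
        ((norm_add_le _ _).trans (by gcongr; exact norm_besselFun_le G x))
    rw [← sq_abs]
    have h2 := pow_le_pow_left₀ (abs_nonneg _) h1 2
    nlinarith [sq_nonneg (‖w x‖ - κ * ‖G‖)]
  have hsub : |(w x + besselFun V x).re - (w x + besselFun W x).re| ≤ κ * ‖V - W‖ := by
    rw [← Complex.sub_re, add_sub_add_left_eq_sub, ← besselFun_sub]
    exact (Complex.abs_re_le_norm _).trans (norm_besselFun_le _ x)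
  set a := (w x + besselFun V x).re
  set b := (w x + besselFun W x).re
  have hlhs : ‖cubic χ (fun x ↦ w x + besselFun V x) x - cubic χ (fun x ↦ w x + besselFun W x) x‖
      = χ x * |a ^ 3 - b ^ 3| := by
    rw [cubic, cubic, ← Complex.ofReal_sub, Complex.norm_real, ← mul_sub, norm_mul,
      Real.norm_eq_abs, Real.norm_eq_abs, abs_of_nonneg (hχ0 x)]
  have h3 := sq_le_add_cube_div (norm_nonneg (w x)) hμ
  have h4 : a ^ 2 + b ^ 2 ≤ 4 * (μ ^ 2 + ‖w x‖ ^ 3 / μ) + 2 * κ ^ 2 * (‖V‖ ^ 2 + ‖W‖ ^ 2) := by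
    have := hre V
    have := hre W
    nlinarith
  rw [hlhs]
  have := hχ0 x
  calc χ x * |a ^ 3 - b ^ 3| ≤ χ x * (3 / 2 * |a - b| * (a ^ 2 + b ^ 2)) := by
        gcongr; exact abs_cube_sub_cube_le a b
    _ ≤ χ x * (3 / 2 * (κ * ‖V - W‖) *
        (4 * (μ ^ 2 + ‖w x‖ ^ 3 / μ) + 2 * κ ^ 2 * (‖V‖ ^ 2 + ‖W‖ ^ 2))) := by gcongr
    _ = _ := by ring

include hχ hχ0 hχ2 hw hb in
theorem norm_source_sub_le (V W : L2) {μ : ℝ} (hμ : 0 < μ) :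
    ‖source χ w V - source χ w W‖ ≤
      (‖besselL2‖ * ‖V - W‖ * (6 / μ)) *
        (eLpNorm (fun x ↦ χ x * ‖w x‖ ^ 3) 2 volume).toReal +
      (‖besselL2‖ * ‖V - W‖ *
        (6 * μ ^ 2 + 3 * ‖besselL2‖ ^ 2 * (‖V‖ ^ 2 + ‖W‖ ^ 2))) *
        (eLpNorm χ 2 volume).toReal := by
  refine norm_le_of_ae_le hb hχ2 (by positivity) (by positivity) ?_
  filter_upwards [source_ae_eq (memLp_cubic hχ hχ0 hχ2 hw hb V),
    source_ae_eq (memLp_cubic hχ hχ0 hχ2 hw hb W),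
    Lp.coeFn_sub (source χ w V) (source χ w W)] with x h₁ h₂ h₃
  rw [h₃, Pi.sub_apply, h₁, h₂]
  exact norm_cubic_sub_le hχ0 V W hμ x

end Bounds

/-- Since 3α ≥ 1, χ is dominated by a multiple of (1+x²)^{-1/2}, whose square is integrable. -/
theorem memLp_two_of_decay {χ : ℝ → ℝ} (hχ : Measurable χ) (hχ0 : ∀ x, 0 ≤ χ x) {c α : ℝ}
    (hα : 1 < α) (h : ∀ x, χ x ≤ c * √(1 + x ^ 2) ^ (-(3 * α))) : MemLp χ 2 volume := by
  rw [memLp_two_iff_integrable_sq hχ.aestronglyMeasurable]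
  have hc : 0 ≤ c := by simpa using (hχ0 0).trans (h 0)
  refine (integrable_inv_one_add_sq.const_mul (c ^ 2)).mono' (hχ.pow_const 2).aestronglyMeasurable
    (Eventually.of_forall fun x ↦ ?_)
  have h1 : 1 ≤ √(1 + x ^ 2) := Real.one_le_sqrt.2 (by nlinarith [sq_nonneg x])
  have h2 : √(1 + x ^ 2) ^ (-(3 * α)) ≤ √(1 + x ^ 2) ^ (-1 : ℝ) :=
    Real.rpow_le_rpow_of_exponent_le h1 (by linarith)
  rw [Real.rpow_neg_one] at h2
  have h3 : χ x ≤ c * (√(1 + x ^ 2))⁻¹ := (h x).trans (by gcongr)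
  rw [Real.norm_eq_abs, abs_of_nonneg (sq_nonneg _)]
  calc χ x ^ 2 ≤ (c * (√(1 + x ^ 2))⁻¹) ^ 2 := pow_le_pow_left₀ (hχ0 x) h3 2
    _ = c ^ 2 * (1 + x ^ 2)⁻¹ := by
      rw [mul_pow, inv_pow, Real.sq_sqrt (by positivity)]

/-! ### Duhamel's formula and mild solutions -/

/-- The Duhamel integral `-i ∫₀ᵗ L(t - τ) n(τ) dτ` in `L²`. -/
def duhamel (n : ℝ → L2) (t : ℝ) : L2 :=
  -Complex.I • flow t (∫ τ in (0 : ℝ)..t, flow (-τ) (n τ))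

theorem aestronglyMeasurable_flow_neg {n : ℝ → L2} (hn : AEStronglyMeasurable n volume) :
    AEStronglyMeasurable (fun τ ↦ flow (-τ) (n τ)) volume :=
  Continuous.comp_aestronglyMeasurable (g := fun p : ℝ × L2 ↦ flow p.1 p.2)
    (f := fun τ ↦ (-τ, n τ)) continuous_flow
    ((continuous_neg.aestronglyMeasurable (μ := (volume : Measure ℝ))).prodMk hn)

theorem integrable_flow_neg {n : ℝ → L2} (hn : Integrable n) :
    Integrable (fun τ ↦ flow (-τ) (n τ)) :=
  hn.mono (aestronglyMeasurable_flow_neg hn.1)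
    (Eventually.of_forall fun τ ↦ (norm_flow (-τ) (n τ)).le)

theorem continuous_duhamel {n : ℝ → L2} (hn : Integrable n) : Continuous (duhamel n) := by
  have h : Continuous fun t ↦ ∫ τ in (0 : ℝ)..t, flow (-τ) (n τ) :=
    intervalIntegral.continuous_primitive
      (fun a b ↦ (integrable_flow_neg hn).intervalIntegrable) 0
  exact (continuous_flow.comp (continuous_id.prodMk h)).const_smul (-Complex.I)

theorem norm_duhamel_le_abs (n : ℝ → L2) (t : ℝ) :
    ‖duhamel n t‖ ≤ |∫ τ in (0 : ℝ)..t, ‖n τ‖| := by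
  rw [duhamel, norm_smul, norm_neg, Complex.norm_I, one_mul, norm_flow]
  refine (intervalIntegral.norm_integral_le_abs_integral_norm).trans ?_
  simp_rw [norm_flow]
  exact le_rfl

theorem abs_intervalIntegral_le_integral {g : ℝ → ℝ} (hg : Integrable g) (h0 : ∀ τ, 0 ≤ g τ)
    (t : ℝ) : |∫ τ in (0 : ℝ)..t, g τ| ≤ ∫ τ, g τ := by
  rw [intervalIntegral.abs_integral_eq_abs_integral_uIoc,
    abs_of_nonneg (integral_nonneg fun τ ↦ h0 τ)]
  exact setIntegral_le_integral hg (Eventually.of_forall h0)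

theorem norm_duhamel_le {n : ℝ → L2} (hn : Integrable n) (t : ℝ) :
    ‖duhamel n t‖ ≤ ∫ τ, ‖n τ‖ :=
  (norm_duhamel_le_abs n t).trans (abs_intervalIntegral_le_integral hn.norm
    (fun _ ↦ norm_nonneg _) t)

theorem duhamel_sub {n n' : ℝ → L2} (hn : Integrable n) (hn' : Integrable n') (t : ℝ) :
    duhamel n t - duhamel n' t = duhamel (fun τ ↦ n τ - n' τ) t := by
  rw [duhamel, duhamel, duhamel, ← smul_sub, ← map_sub,
    ← intervalIntegral.integral_sub (integrable_flow_neg hn).intervalIntegrable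
      (integrable_flow_neg hn').intervalIntegrable]
  simp_rw [map_sub]

/-- Existence of a mild solution in the ball of radius `R` by contraction. -/
theorem exists_mild_solution {n : ℝ → L2 → L2} {R : ℝ} (hR : 0 ≤ R) {g ℓ : ℝ → ℝ}
    (hmeas : ∀ V : ℝ → L2, Continuous V → AEStronglyMeasurable (fun τ ↦ n τ (V τ)) volume)
    (hg : Integrable g) (hgn : ∀ᵐ τ, ∀ V, ‖V‖ ≤ R → ‖n τ V‖ ≤ g τ) (hgR : ∫ τ, g τ ≤ R)
    (hℓ : Integrable ℓ) (hℓ0 : ∀ t, 0 ≤ ℓ t)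
    (hℓn : ∀ᵐ τ, ∀ V W, ‖V‖ ≤ R → ‖W‖ ≤ R → ‖n τ V - n τ W‖ ≤ ℓ τ * ‖V - W‖)
    (hℓ2 : ∫ τ, ℓ τ ≤ 1 / 2) :
    ∃ V : ℝ → L2, Continuous V ∧ (∀ t, ‖V t‖ ≤ R) ∧ Integrable (fun τ ↦ n τ (V τ)) ∧
      ∀ t, V t = duhamel (fun τ ↦ n τ (V τ)) t := by
  -- The fixed point is sought among bounded continuous functions on the whole time line: the time
  -- cutoff sits in n, and the weights g and ℓ are integrable on ℝ.
  let B : Set (ℝ →ᵇ L2) := Metric.closedBall 0 R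
  have hB : ∀ V : B, ∀ t, ‖(V : ℝ →ᵇ L2) t‖ ≤ R := fun V t ↦
    ((V : ℝ →ᵇ L2).norm_coe_le_norm t).trans (mem_closedBall_zero_iff.1 V.2)
  have hint : ∀ V : B, Integrable fun τ ↦ n τ ((V : ℝ →ᵇ L2) τ) := fun V ↦
    hg.mono' (hmeas _ (V : ℝ →ᵇ L2).continuous) (hgn.mono fun τ h ↦ h _ (hB V τ))
  have hbd : ∀ V : B, ∀ t, ‖duhamel (fun τ ↦ n τ ((V : ℝ →ᵇ L2) τ)) t‖ ≤ R := fun V t ↦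
    (norm_duhamel_le (hint V) t).trans ((integral_mono_ae (hint V).norm hg
      (hgn.mono fun τ h ↦ h _ (hB V τ))).trans hgR)
  let Φ : B → B := fun V ↦ ⟨BoundedContinuousFunction.ofNormedAddCommGroup
    (duhamel fun τ ↦ n τ ((V : ℝ →ᵇ L2) τ)) (continuous_duhamel (hint V)) R (hbd V),
    mem_closedBall_zero_iff.2 ((BoundedContinuousFunction.norm_le hR).2 (hbd V))⟩
  have hΦ : ContractingWith (1 / 2 : NNReal) Φ := by
    refine ⟨by norm_num, LipschitzWith.of_dist_le_mul fun V W ↦ ?_⟩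
    change dist (Φ V : ℝ →ᵇ L2) (Φ W : ℝ →ᵇ L2) ≤ _ * dist (V : ℝ →ᵇ L2) (W : ℝ →ᵇ L2)
    refine (BoundedContinuousFunction.dist_le (by positivity)).2 fun t ↦ ?_
    change dist (duhamel _ t) (duhamel _ t) ≤ _
    rw [dist_eq_norm, duhamel_sub (hint V) (hint W)]
    refine (norm_duhamel_le ((hint V).sub (hint W)) t).trans ?_
    calc ∫ τ, ‖n τ ((V : ℝ →ᵇ L2) τ) - n τ ((W : ℝ →ᵇ L2) τ)‖
        ≤ ∫ τ, ℓ τ * dist (V : ℝ →ᵇ L2) (W : ℝ →ᵇ L2) := by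
          refine integral_mono_ae ((hint V).sub (hint W)).norm (hℓ.mul_const _) ?_
          filter_upwards [hℓn] with τ h
          refine (h _ _ (hB V τ) (hB W τ)).trans ?_
          rw [← dist_eq_norm]
          exact mul_le_mul_of_nonneg_left (BoundedContinuousFunction.dist_coe_le_dist τ) (hℓ0 τ)
      _ = (∫ τ, ℓ τ) * dist (V : ℝ →ᵇ L2) (W : ℝ →ᵇ L2) := integral_mul_const _ _
      _ ≤ _ := by
          gcongr
          simpa using hℓ2
  have : CompleteSpace B := Metric.isClosed_closedBall.completeSpace_coe
  have : Nonempty B := ⟨⟨0, by simp [B, hR]⟩⟩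
  set V := hΦ.fixedPoint Φ
  have hfix : Φ V = V := hΦ.fixedPoint_isFixedPt
  refine ⟨(V : ℝ →ᵇ L2), (V : ℝ →ᵇ L2).continuous, hB V, hint V, fun t ↦ ?_⟩
  have := congrArg (fun V : B ↦ (V : ℝ →ᵇ L2) t) hfix
  exact this.symm

/-- A form of Grönwall's inequality with an integrable kernel. -/
theorem eq_zero_of_le_integral {T : ℝ} (hT : 0 ≤ T) {e ℓ : ℝ → ℝ} (he : Continuous e)
    (he0 : ∀ t, 0 ≤ e t) (hℓ : Integrable ℓ) (hℓ0 : ∀ t, 0 ≤ ℓ t)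
    (h : ∀ t ∈ Icc 0 T, e t ≤ ∫ τ in (0 : ℝ)..t, ℓ τ * e τ) : ∀ t ∈ Icc 0 T, e t = 0 := by
  -- Membership of t means that e vanishes on the whole segment from 0 to t. This set is closed, so
  -- it suffices to push it slightly beyond each of its points below T.
  set s : Set ℝ := {t | ∀ θ ∈ Icc (0 : ℝ) 1, e (θ * t) = 0} with hs
  have hclosed : IsClosed s := by
    simp only [hs, ofPred_forall]
    refine isClosed_iInter fun θ ↦ isClosed_iInter fun _ ↦ ?_
    exact isClosed_eq (he.comp (continuous_const.mul continuous_id)) continuous_const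
  have hs' : ∀ t ∈ s, ∀ r ∈ Icc 0 t, e r = 0 := by
    intro t ht r hr
    rcases eq_or_lt_of_le (hr.1.trans hr.2) with h0 | h0
    · have : r = 0 := le_antisymm (h0 ▸ hr.2) hr.1
      simpa [this] using ht 0 (by simp)
    · have := ht (r / t) ⟨div_nonneg hr.1 h0.le, div_le_one_of_le₀ hr.2 h0.le⟩
      rwa [div_mul_cancel₀ _ h0.ne'] at this
  have hsub : Icc 0 T ⊆ s := by
    refine (hclosed.inter isClosed_Icc).Icc_subset_of_forall_exists_gt ?_ ?_
    · intro θ _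
      have := h 0 ⟨le_rfl, hT⟩
      rw [intervalIntegral.integral_same] at this
      rw [mul_zero]
      exact le_antisymm this (he0 0)
    · rintro x ⟨hx, hx0⟩ y hy
      have hii : ∀ a b, IntervalIntegrable ℓ volume a b := fun a b ↦ hℓ.intervalIntegrable
      have hcont : Continuous fun t ↦ ∫ τ in x..t, ℓ τ :=
        intervalIntegral.continuous_primitive hii x
      have hev : ∀ᶠ t in 𝓝[>] x, ∫ τ in x..t, ℓ τ < 1 / 2 := by
        have := hcont.tendsto x
        rw [intervalIntegral.integral_same] at this
        exact nhdsWithin_le_nhds (this.eventually_lt_const (by norm_num))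
      have hev2 : ∀ᶠ t in 𝓝[>] x, t ∈ Ioc x (min y T) :=
        Ioc_mem_nhdsGT (lt_min hy hx0.2)
      obtain ⟨t, ht1, ht2⟩ := (hev.and hev2).exists
      refine ⟨t, ?_, ht2.1, ht2.2.trans (min_le_left _ _)⟩
      have htT : t ≤ T := ht2.2.trans (min_le_right _ _)
      -- At a maximum point p of e on [x, t] the hypothesis gives e(p) ≤ e(p) ∫ₓᵗ ℓ ≤ e(p)/2, which
      -- forces e(p) = 0.
      obtain ⟨p, hp, hpmax⟩ := isCompact_Icc.exists_isMaxOn (nonempty_Icc.2 ht2.1.le)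
        (he.continuousOn (s := Icc x t))
      have hpz : e p ≤ 0 := by
        have h1 := h p ⟨hx0.1.trans hp.1, hp.2.trans htT⟩
        have hie : ∀ a b, IntervalIntegrable (fun τ ↦ ℓ τ * e τ) volume a b := fun a b ↦
          (hii a b).mul_continuousOn he.continuousOn
        rw [← intervalIntegral.integral_add_adjacent_intervals (hie 0 x) (hie x p)] at h1
        have h2 : ∫ τ in (0 : ℝ)..x, ℓ τ * e τ = 0 := by
          rw [intervalIntegral.integral_congr (g := fun _ ↦ (0 : ℝ))]
          · simp
          · intro τ hτ
            rw [uIcc_of_le hx0.1] at hτ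
            simp [hs' x hx τ hτ]
        have h3 : ∫ τ in x..p, ℓ τ * e τ ≤ ∫ τ in x..p, ℓ τ * e p := by
          refine intervalIntegral.integral_mono_on hp.1 (hie x p) ((hii x p).mul_const _) ?_
          intro τ hτ
          exact mul_le_mul_of_nonneg_left (hpmax ⟨hτ.1, hτ.2.trans hp.2⟩) (hℓ0 τ)
        have h4 : ∫ τ in x..p, ℓ τ ≤ ∫ τ in x..t, ℓ τ := by
          refine intervalIntegral.integral_mono_interval le_rfl hp.1 hp.2
            (Eventually.of_forall hℓ0) (hii x t)
        rw [intervalIntegral.integral_mul_const] at h3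
        nlinarith [he0 p]
      intro θ hθ
      have ht0 : 0 ≤ t := hx0.1.trans ht2.1.le
      have hr0 : 0 ≤ θ * t := mul_nonneg hθ.1 ht0
      have hrt : θ * t ≤ t := mul_le_of_le_one_left ht0 hθ.2
      rcases le_total (θ * t) x with hle | hle
      · exact hs' x hx _ ⟨hr0, hle⟩
      · exact le_antisymm ((hpmax ⟨hle, hrt⟩).trans hpz) (he0 _)
  intro t ht
  exact hs' t (hsub ht) t ⟨ht.1, le_rfl⟩

/-- Uniqueness of mild solutions. -/
theorem mild_solution_unique {n : ℝ → L2 → L2} {T R : ℝ} (hT : 0 ≤ T) {ℓ : ℝ → ℝ}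
    (hℓ : Integrable ℓ) (hℓ0 : ∀ t, 0 ≤ ℓ t)
    (hℓn : ∀ᵐ τ, ∀ V W, ‖V‖ ≤ R → ‖W‖ ≤ R → ‖n τ V - n τ W‖ ≤ ℓ τ * ‖V - W‖)
    {V W : ℝ → L2} (hV : Continuous V) (hW : Continuous W) (hVR : ∀ t, ‖V t‖ ≤ R)
    (hWR : ∀ t, ‖W t‖ ≤ R) (hVi : Integrable fun τ ↦ n τ (V τ))
    (hWi : Integrable fun τ ↦ n τ (W τ))
    (hVd : ∀ t ∈ Icc (-T) T, V t = duhamel (fun τ ↦ n τ (V τ)) t)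
    (hWd : ∀ t ∈ Icc (-T) T, W t = duhamel (fun τ ↦ n τ (W τ)) t) : EqOn V W (Icc (-T) T) := by
  set e : ℝ → ℝ := fun t ↦ ‖V t - W t‖ with he
  have hec : Continuous e := (hV.sub hW).norm
  have he0 : ∀ t, 0 ≤ e t := fun t ↦ norm_nonneg _
  have hie : ∀ a b, IntervalIntegrable (fun τ ↦ ℓ τ * e τ) volume a b := fun a b ↦
    hℓ.intervalIntegrable.mul_continuousOn hec.continuousOn
  have key : ∀ t ∈ Icc (-T) T, e t ≤ |∫ τ in (0 : ℝ)..t, ℓ τ * e τ| := by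
    intro t ht
    rw [he]
    simp only
    rw [hVd t ht, hWd t ht, duhamel_sub hVi hWi]
    refine (norm_duhamel_le_abs _ t).trans ?_
    rw [intervalIntegral.abs_integral_eq_abs_integral_uIoc,
      intervalIntegral.abs_integral_eq_abs_integral_uIoc,
      abs_of_nonneg (integral_nonneg fun τ ↦ norm_nonneg _),
      abs_of_nonneg (integral_nonneg fun τ ↦ mul_nonneg (hℓ0 τ) (he0 τ))]
    refine setIntegral_mono_ae (hVi.sub hWi).norm.integrableOn
      (intervalIntegrable_iff.1 (hie 0 t)) ?_
    filter_upwards [hℓn] with τ h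
    exact h _ _ (hVR τ) (hWR τ)
  have hpos := eq_zero_of_le_integral hT hec he0 hℓ hℓ0 fun t ht ↦ by
    have h1 := key t ⟨by linarith [ht.1], ht.2⟩
    rwa [abs_of_nonneg (intervalIntegral.integral_nonneg ht.1
      fun τ _ ↦ mul_nonneg (hℓ0 τ) (he0 τ))] at h1
  -- Negative times follow by reflecting e and ℓ.
  have hneg := eq_zero_of_le_integral hT (hec.comp continuous_neg) (fun t ↦ he0 (-t))
    hℓ.comp_neg (fun t ↦ hℓ0 (-t)) fun t ht ↦ by
    have h1 := key (-t) ⟨by linarith [ht.2], by linarith [ht.1]⟩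
    have h2 := intervalIntegral.integral_comp_neg (a := 0) (b := t) (fun τ ↦ ℓ τ * e τ)
    rw [neg_zero] at h2
    have h3 : 0 ≤ ∫ τ in (0 : ℝ)..t, ℓ (-τ) * e (-τ) :=
      intervalIntegral.integral_nonneg ht.1 fun τ _ ↦ mul_nonneg (hℓ0 _) (he0 _)
    rw [intervalIntegral.integral_symm, abs_neg, ← h2, abs_of_nonneg h3] at h1
    exact h1
  intro t ht
  have hzero : e t = 0 := by
    rcases le_total 0 t with h0 | h0
    · exact hpos t ⟨h0, ht.2⟩
    · simpa using hneg (-t) ⟨by linarith, by linarith [ht.1]⟩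
  exact sub_eq_zero.1 (norm_eq_zero.1 hzero)

/-! ### Mild solutions solve the differential equation, and conversely -/

theorem integral_triangle_swap_of_nonneg {E : Type*} [NormedAddCommGroup E] [NormedSpace ℝ E]
    {F : ℝ → ℝ → E} {t : ℝ} (ht : 0 ≤ t)
    (hF : Integrable (Function.uncurry F)
      ((volume.restrict (Ioc 0 t)).prod (volume.restrict (Ioc 0 t)))) :
    ∫ τ in (0 : ℝ)..t, ∫ s in τ..t, F s τ = ∫ s in (0 : ℝ)..t, ∫ τ in (0 : ℝ)..s, F s τ := by
  set G : ℝ → ℝ → E := fun s τ ↦ {p : ℝ × ℝ | p.2 < p.1}.indicator (Function.uncurry F) (s, τ)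
    with hG
  have hset : MeasurableSet {p : ℝ × ℝ | p.2 < p.1} :=
    measurableSet_lt measurable_snd measurable_fst
  have hGi : Integrable (Function.uncurry G)
      ((volume.restrict (Ioc 0 t)).prod (volume.restrict (Ioc 0 t))) := hF.indicator hset
  have h1 : ∫ τ in (0 : ℝ)..t, ∫ s in τ..t, F s τ =
      ∫ τ in Ioc 0 t, ∫ s in Ioc 0 t, G s τ := by
    rw [intervalIntegral.integral_of_le ht]
    refine setIntegral_congr_fun measurableSet_Ioc fun τ hτ ↦ ?_
    rw [intervalIntegral.integral_of_le hτ.2]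
    have e : (fun s ↦ G s τ) = (Ioi τ).indicator fun s ↦ F s τ := by
      ext s
      simp [hG, indicator]
    have e2 : Ioc 0 t ∩ Ioi τ = Ioc τ t := by
      ext s
      simp only [mem_inter_iff, mem_Ioc, mem_Ioi]
      exact ⟨fun h ↦ ⟨h.2, h.1.2⟩, fun h ↦ ⟨⟨hτ.1.trans h.1, h.2⟩, h.1⟩⟩
    rw [e, setIntegral_indicator measurableSet_Ioi, e2]
  have h2 : ∫ s in (0 : ℝ)..t, ∫ τ in (0 : ℝ)..s, F s τ =
      ∫ s in Ioc 0 t, ∫ τ in Ioc 0 t, G s τ := by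
    rw [intervalIntegral.integral_of_le ht]
    refine setIntegral_congr_fun measurableSet_Ioc fun s hs ↦ ?_
    -- The indicator carries the strict inequality τ < s, so the endpoint τ = s, a null set, has to
    -- be removed.
    rw [intervalIntegral.integral_of_le hs.1.le, integral_Ioc_eq_integral_Ioo]
    have e : G s = (Iio s).indicator fun τ ↦ F s τ := by
      ext τ
      simp [hG, indicator]
    have e2 : Ioc 0 t ∩ Iio s = Ioo 0 s := by
      ext τ
      simp only [mem_inter_iff, mem_Ioc, mem_Iio, mem_Ioo]
      exact ⟨fun h ↦ ⟨h.1.1, h.2⟩, fun h ↦ ⟨⟨h.1, h.2.le.trans hs.2⟩, h.2⟩⟩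
    rw [e, setIntegral_indicator measurableSet_Iio, e2]
  rw [h1, h2, integral_integral_swap hGi]

/-- Fubini's theorem for an iterated integral over a triangle. -/
theorem integral_triangle_swap {E : Type*} [NormedAddCommGroup E] [NormedSpace ℝ E]
    {F : ℝ → ℝ → E} (hF : ∀ a b : ℝ, Integrable (Function.uncurry F)
      ((volume.restrict (Ioc a b)).prod (volume.restrict (Ioc a b)))) (t : ℝ) :
    ∫ τ in (0 : ℝ)..t, ∫ s in τ..t, F s τ = ∫ s in (0 : ℝ)..t, ∫ τ in (0 : ℝ)..s, F s τ := by
  rcases le_total 0 t with ht | ht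
  · exact integral_triangle_swap_of_nonneg ht (hF 0 t)
  · have hF' : Integrable (Function.uncurry fun s τ ↦ F (-s) (-τ))
        ((volume.restrict (Ioc 0 (-t))).prod (volume.restrict (Ioc 0 (-t)))) := by
      have hp : MeasurePreserving (fun x : ℝ ↦ -x) (volume.restrict (Ioc 0 (-t)))
          (volume.restrict (Ioc t 0)) := by
        have := (Measure.measurePreserving_neg (volume : Measure ℝ)).restrict_preimage
          (measurableSet_Ico (a := t) (b := 0))
        rw [neg_preimage, neg_Ico, neg_zero] at this
        rwa [restrict_Ico_eq_restrict_Ioc] at this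
      exact (hp.prod hp).integrable_comp_of_integrable (hF t 0)
    have h := integral_triangle_swap_of_nonneg (neg_nonneg.2 ht) hF'
    have e1 : ∀ τ, ∫ s in τ..-t, F (-s) (-τ) = -∫ s in (-τ)..t, F s (-τ) := by
      intro τ
      rw [intervalIntegral.integral_comp_neg (fun s ↦ F s (-τ)), neg_neg,
        intervalIntegral.integral_symm]
    have e2 : ∀ s, ∫ τ in (0 : ℝ)..s, F (-s) (-τ) = -∫ τ in (0 : ℝ)..(-s), F (-s) τ := by
      intro s
      rw [intervalIntegral.integral_comp_neg (fun τ ↦ F (-s) τ), neg_zero,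
        intervalIntegral.integral_symm]
    simp_rw [e1, e2] at h
    rw [intervalIntegral.integral_neg, intervalIntegral.integral_neg, neg_inj,
      intervalIntegral.integral_comp_neg (fun τ ↦ ∫ s in τ..t, F s τ),
      intervalIntegral.integral_comp_neg (fun s ↦ ∫ τ in (0 : ℝ)..s, F s τ), neg_zero, neg_neg,
      intervalIntegral.integral_symm, intervalIntegral.integral_symm 0 t, neg_inj] at h
    exact h

theorem bessel_flow_sub (f : L2) (τ t : ℝ) :
    bessel (flow t f) = bessel (flow τ f) + ∫ s in τ..t, -Complex.I • flow s f := by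
  have hc : Continuous fun s ↦ -Complex.I • flow s f :=
    (continuous_flow_apply f).const_smul (-Complex.I)
  rw [intervalIntegral.integral_eq_sub_of_hasDerivAt (fun s _ ↦ hasDerivAt_bessel_flow f s)
    (hc.intervalIntegrable _ _)]
  abel

theorem integrable_flow_prod {w : ℝ → L2} (hw : Integrable w) (a b : ℝ) :
    Integrable (Function.uncurry fun s τ ↦ -Complex.I • flow s (w τ))
      ((volume.restrict (Ioc a b)).prod (volume.restrict (Ioc a b))) := by
  have h1 : Integrable (fun p : ℝ × ℝ ↦ w p.2)
      ((volume.restrict (Ioc a b)).prod (volume.restrict (Ioc a b))) :=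
    hw.integrableOn.comp_snd _
  have h2 : AEStronglyMeasurable (fun p : ℝ × ℝ ↦ flow p.1 (w p.2))
      ((volume.restrict (Ioc a b)).prod (volume.restrict (Ioc a b))) :=
    Continuous.comp_aestronglyMeasurable (g := fun p : ℝ × L2 ↦ flow p.1 p.2)
      (f := fun p : ℝ × ℝ ↦ (p.1, w p.2)) continuous_flow
      (continuous_fst.aestronglyMeasurable.prodMk h1.1)
  have h3 : Integrable (fun p : ℝ × ℝ ↦ flow p.1 (w p.2))
      ((volume.restrict (Ioc a b)).prod (volume.restrict (Ioc a b))) :=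
    h1.mono h2 (Eventually.of_forall fun p ↦ (norm_flow _ _).le)
  exact h3.smul (-Complex.I)

/-- With w(τ) = L(-τ)n(τ), expand D⁻¹L(t)w(τ) as D⁻¹n(τ) plus the integral of its time derivative
from τ to t, then exchange the order of integration on the triangle. Working under D⁻¹ keeps every
term in L². -/
theorem I_smul_bessel_duhamel {n : ℝ → L2} (hn : Integrable n) (t : ℝ) :
    Complex.I • bessel (duhamel n t) =
      ∫ τ in (0 : ℝ)..t, (duhamel n τ + bessel (n τ)) := by
  set w : ℝ → L2 := fun τ ↦ flow (-τ) (n τ) with hw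
  have hwi : Integrable w := integrable_flow_neg hn
  have hwn : ∀ τ, flow τ (w τ) = n τ := fun τ ↦ by
    rw [hw]; simp only; rw [flow_flow, add_neg_cancel, flow_zero]
  have hbn : Integrable fun τ ↦ bessel (n τ) := bessel.integrable_comp hn
  have e0 : Complex.I • bessel (duhamel n t) =
      ∫ τ in (0 : ℝ)..t, bessel (flow t (w τ)) := by
    rw [duhamel, map_smul, smul_smul, mul_neg, Complex.I_mul_I, neg_neg, one_smul]
    exact (((bessel.comp (flow t)).intervalIntegral_comp_comm hwi.intervalIntegrable).symm)
  -- The inner integral is a difference of two functions already known to be integrable, so no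
  -- separate Fubini argument is needed here.
  have hii : IntervalIntegrable (fun τ ↦ ∫ s in τ..t, -Complex.I • flow s (w τ)) volume 0 t := by
    have h1 : IntervalIntegrable (fun τ ↦ bessel (flow t (w τ)) - bessel (n τ)) volume 0 t :=
      (((bessel.comp (flow t)).integrable_comp hwi).sub hbn).intervalIntegrable
    refine h1.congr fun τ _ ↦ ?_
    rw [bessel_flow_sub (w τ) τ t, hwn, add_sub_cancel_left]
  have e1 : ∫ τ in (0 : ℝ)..t, bessel (flow t (w τ)) = (∫ τ in (0 : ℝ)..t, bessel (n τ)) +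
      ∫ τ in (0 : ℝ)..t, ∫ s in τ..t, -Complex.I • flow s (w τ) := by
    rw [← intervalIntegral.integral_add hbn.intervalIntegrable hii]
    refine intervalIntegral.integral_congr fun τ _ ↦ ?_
    rw [bessel_flow_sub (w τ) τ t, hwn]
  have e2 : ∀ s, ∫ τ in (0 : ℝ)..s, -Complex.I • flow s (w τ) = duhamel n s := by
    intro s
    rw [intervalIntegral.integral_smul, duhamel,
      (flow s).intervalIntegral_comp_comm hwi.intervalIntegrable]
  rw [e0, e1, integral_triangle_swap (integrable_flow_prod hwi), add_comm]
  simp_rw [e2]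
  rw [intervalIntegral.integral_add ((continuous_duhamel hn).intervalIntegrable _ _)
    hbn.intervalIntegrable]

/-- For e(t) = ∫₀ᵗ d one has e' = d and e = iD⁻¹d. Since D⁻¹ is symmetric, the derivative of ‖e‖² is
twice the real part of -i⟨D⁻¹d, d⟩, which is zero. As e(0) = 0, both e and D⁻¹d vanish. -/
theorem eq_zero_of_I_smul_bessel_eq {T : ℝ} {d : ℝ → L2} (hd : Continuous d)
    (h : ∀ t ∈ Icc (-T) T, Complex.I • bessel (d t) = ∫ τ in (0 : ℝ)..t, d τ) :
    ∀ t ∈ Icc (-T) T, d t = 0 := by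
  intro t ht
  set e : ℝ → L2 := fun t ↦ ∫ τ in (0 : ℝ)..t, d τ with he
  have hder : ∀ t, HasDerivAt e (d t) t := fun t ↦ hd.integral_hasStrictDerivAt 0 t |>.hasDerivAt
  have hder2 : ∀ t ∈ Icc (-T) T, HasDerivAt (fun t ↦ ⟪e t, e t⟫_ℂ) 0 t := by
    intro t ht
    have h1 := (hder t).inner ℂ (hder t)
    have h2 : ⟪e t, d t⟫_ℂ + ⟪d t, e t⟫_ℂ = 0 := by
      have h3 : e t = Complex.I • bessel (d t) := (h t ht).symm
      have h4 := Complex.conj_eq_iff_im.2 (inner_bessel_self_im (d t))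
      rw [inner_conj_symm] at h4
      rw [h3, inner_smul_left, inner_smul_right, h4, Complex.conj_I]
      ring
    rwa [h2] at h1
  have hconst := constant_of_has_deriv_right_zero (a := -T) (b := T)
    (f := fun t ↦ ⟪e t, e t⟫_ℂ)
    (fun t ht ↦ (hder2 t ht).continuousAt.continuousWithinAt)
    (fun t ht ↦ (hder2 t (Ico_subset_Icc_self ht)).hasDerivWithinAt)
  have h0 : (0 : ℝ) ∈ Icc (-T) T := by
    have := ht.1.trans ht.2
    constructor <;> linarith
  have h5 : ⟪e t, e t⟫_ℂ = 0 := by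
    rw [hconst t ht, ← hconst 0 h0, he]
    simp
  have h6 : Complex.I • bessel (d t) = 0 := by
    rw [h t ht]
    exact inner_self_eq_zero.1 h5
  exact bessel_injective ((smul_eq_zero.1 h6).resolve_left Complex.I_ne_zero)

theorem eq_duhamel_of_I_smul_bessel_eq {T : ℝ} {V n : ℝ → L2} (hV : Continuous V)
    (hn : Integrable n)
    (h : ∀ t ∈ Icc (-T) T, Complex.I • bessel (V t) = ∫ τ in (0 : ℝ)..t, (V τ + bessel (n τ))) :
    ∀ t ∈ Icc (-T) T, V t = duhamel n t := by
  have hc := continuous_duhamel hn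
  have hbn : Integrable fun τ ↦ bessel (n τ) := bessel.integrable_comp hn
  have key := eq_zero_of_I_smul_bessel_eq (T := T) (hV.sub hc) fun t ht ↦ by
    simp only [Pi.sub_apply]
    rw [map_sub, smul_sub, h t ht, I_smul_bessel_duhamel hn,
      ← intervalIntegral.integral_sub]
    · simp
    · exact (hV.intervalIntegrable _ _).add hbn.intervalIntegrable
    · exact (hc.intervalIntegrable _ _).add hbn.intervalIntegrable
  intro t ht
  exact sub_eq_zero.1 (key t ht)

/-- The pairing of `L²` with a Schwartz function. -/
def pairL2 (φ : 𝓢(ℝ, ℂ)) : L2 →L[ℂ] ℂ :=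
  (PointwiseConvergenceCLM.evalCLM (RingHom.id ℂ) ℂ φ).comp
    (Lp.toTemperedDistributionCLM ℂ volume 2)

theorem pairL2_apply (φ : 𝓢(ℝ, ℂ)) (f : L2) : pairL2 φ f = (f : 𝓢'(ℝ, ℂ)) φ := rfl

theorem eq_of_forall_pairL2_eq {f g : L2} (h : ∀ φ, pairL2 φ f = pairL2 φ g) : f = g := by
  apply coe_Lp_injective
  ext φ
  exact h φ

/-! ### Estimates in time for the linear flow -/

/-- The `L²` norm of `χ |z(τ)|³`. -/
def cubeNorm (χ : ℝ → ℝ) (z : ℝ → ℝ → ℂ) (τ : ℝ) : ℝ≥0∞ :=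
  eLpNorm (fun x ↦ χ x * ‖z τ x‖ ^ 3) 2 volume

theorem measurable_cubeNorm {χ : ℝ → ℝ} (hχ : Measurable χ) {z : ℝ → ℝ → ℂ}
    (hz : Measurable (Function.uncurry z)) : Measurable (cubeNorm χ z) := by
  have : Measurable (Function.uncurry fun τ x ↦ χ x * ‖z τ x‖ ^ 3) :=
    (hχ.comp measurable_snd).mul (hz.norm.pow_const 3)
  exact measurable_eLpNorm_two this

/-- Both sides are ∫ χ²|z|⁶; this converts the L⁶ hypothesis into a bound for `cubeNorm` in L² of
time. -/
theorem cubeNorm_sq {χ : ℝ → ℝ} (hχ0 : ∀ x, 0 ≤ χ x) (z : ℝ → ℝ → ℂ) (τ : ℝ) :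
    cubeNorm χ z τ ^ (2 : ℝ) =
      eLpNorm (fun x ↦ χ x ^ (1 / 3 : ℝ) * ‖z τ x‖) 6 volume ^ (6 : ℝ) := by
  have h2 := eLpNorm_nnreal_pow_eq_lintegral (μ := (volume : Measure ℝ)) (p := 2)
    (f := fun x ↦ χ x * ‖z τ x‖ ^ 3) (by norm_num)
  have h6 := eLpNorm_nnreal_pow_eq_lintegral (μ := (volume : Measure ℝ)) (p := 6)
    (f := fun x ↦ χ x ^ (1 / 3 : ℝ) * ‖z τ x‖) (by norm_num)
  norm_num at h2 h6
  rw [cubeNorm]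
  norm_num
  rw [h2, h6]
  refine lintegral_congr fun x ↦ ?_
  have e : χ x = (χ x ^ (1 / 3 : ℝ)) ^ 3 := by
    rw [← Real.rpow_natCast, ← Real.rpow_mul (hχ0 x)]
    norm_num
  conv_lhs => rw [e]
  rw [enorm_pow]
  ring

theorem lintegral_cubeNorm_sq_le {χ : ℝ → ℝ} (hχ0 : ∀ x, 0 ≤ χ x) {z : ℝ → ℝ → ℂ} {Λ : ℝ}
    (h : eLpNorm (fun τ ↦ eLpNorm (fun x ↦ χ x ^ (1 / 3 : ℝ) * ‖z τ x‖) 6 volume) 6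
      (volume.restrict (Icc (-1 : ℝ) 1)) ≤ ENNReal.ofReal Λ) :
    ∫⁻ τ in Icc (-1 : ℝ) 1, cubeNorm χ z τ ^ (2 : ℝ) ≤ ENNReal.ofReal Λ ^ (6 : ℝ) := by
  simp_rw [cubeNorm_sq hχ0]
  have h6 := eLpNorm_nnreal_pow_eq_lintegral (μ := volume.restrict (Icc (-1 : ℝ) 1)) (p := 6)
    (f := fun τ ↦ eLpNorm (fun x ↦ χ x ^ (1 / 3 : ℝ) * ‖z τ x‖) 6 volume) (by norm_num)
  simp only [enorm_eq_self] at h6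
  norm_num at h6 ⊢
  rw [← h6]
  gcongr

/-- Young's inequality in a form that replaces Cauchy–Schwarz in time once l is chosen well. -/
theorem ennreal_le_add_inv_mul_sq (l β : ℝ≥0∞) (hl : l ≠ 0) (hl' : l ≠ ⊤) :
    β ≤ l + l⁻¹ * β ^ (2 : ℝ) := by
  rcases le_total β l with h | h
  · exact h.trans le_self_add
  · refine le_trans ?_ le_add_self
    calc β = l⁻¹ * (l * β) := by rw [← mul_assoc, ENNReal.inv_mul_cancel hl hl', one_mul]
      _ ≤ l⁻¹ * (β * β) := by gcongr
      _ = _ := by rw [ENNReal.rpow_two, sq]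

theorem lintegral_cubeNorm_le {χ : ℝ → ℝ} {z : ℝ → ℝ → ℂ} {Λ σ : ℝ}
    (hΛ : 0 < Λ) (hσ : 0 < σ) (hσ1 : σ ≤ 1)
    (h : ∫⁻ τ in Icc (-1 : ℝ) 1, cubeNorm χ z τ ^ (2 : ℝ) ≤ ENNReal.ofReal Λ ^ (6 : ℝ)) :
    ∫⁻ τ in Icc (-σ ^ 2) (σ ^ 2), cubeNorm χ z τ ≤ ENNReal.ofReal (3 * σ * Λ ^ 3) := by
  -- This choice balances the two contributions, which become 2σΛ³ from the length of the interval
  -- and σΛ³ from the L² bound.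
  set lam : ℝ := Λ ^ 3 / σ with hlam
  have hlam0 : 0 < lam := by positivity
  have hl0 : ENNReal.ofReal lam ≠ 0 := by simpa using hlam0
  have hsub : Icc (-σ ^ 2) (σ ^ 2) ⊆ Icc (-1 : ℝ) 1 := by
    apply Icc_subset_Icc <;> nlinarith
  calc ∫⁻ τ in Icc (-σ ^ 2) (σ ^ 2), cubeNorm χ z τ
      ≤ ∫⁻ τ in Icc (-σ ^ 2) (σ ^ 2),
        (ENNReal.ofReal lam + (ENNReal.ofReal lam)⁻¹ * cubeNorm χ z τ ^ (2 : ℝ)) :=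
        lintegral_mono fun τ ↦ ennreal_le_add_inv_mul_sq _ _ hl0 ENNReal.ofReal_ne_top
    _ = ENNReal.ofReal lam * volume (Icc (-σ ^ 2) (σ ^ 2)) + (ENNReal.ofReal lam)⁻¹ *
        ∫⁻ τ in Icc (-σ ^ 2) (σ ^ 2), cubeNorm χ z τ ^ (2 : ℝ) := by
        rw [lintegral_add_left measurable_const, setLIntegral_const,
          lintegral_const_mul' _ _ (ENNReal.inv_ne_top.2 hl0)]
    _ ≤ ENNReal.ofReal lam * ENNReal.ofReal (2 * σ ^ 2) +
        (ENNReal.ofReal lam)⁻¹ * ENNReal.ofReal Λ ^ (6 : ℝ) := by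
        rw [Real.volume_Icc, show σ ^ 2 - -σ ^ 2 = 2 * σ ^ 2 by ring]
        gcongr
        exact (lintegral_mono_set hsub).trans h
    _ = ENNReal.ofReal (3 * σ * Λ ^ 3) := by
        rw [← ENNReal.ofReal_inv_of_pos hlam0, ENNReal.ofReal_rpow_of_pos hΛ,
          ← ENNReal.ofReal_mul hlam0.le, ← ENNReal.ofReal_mul (by positivity),
          ← ENNReal.ofReal_add (by positivity) (by positivity)]
        congr 1
        rw [hlam, show (6 : ℝ) = ((6 : ℕ) : ℝ) by norm_num, Real.rpow_natCast]
        field_simp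
        ring

theorem ae_cubeNorm_lt_top {χ : ℝ → ℝ} (hχ : Measurable χ) {z : ℝ → ℝ → ℂ}
    (hz : Measurable (Function.uncurry z)) {Λ T : ℝ} (hT : T ≤ 1)
    (h : ∫⁻ τ in Icc (-1 : ℝ) 1, cubeNorm χ z τ ^ (2 : ℝ) ≤ ENNReal.ofReal Λ ^ (6 : ℝ)) :
    ∀ᵐ τ, τ ∈ Icc (-T) T → cubeNorm χ z τ < ⊤ := by
  have h1 := ae_lt_top ((measurable_cubeNorm hχ hz).pow_const (2 : ℝ))
    (h.trans_lt (by finiteness)).ne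
  rw [ae_restrict_iff' measurableSet_Icc] at h1
  filter_upwards [h1] with τ h2 hτ
  have h3 := h2 ⟨by linarith [hτ.1], by linarith [hτ.2]⟩
  by_contra hcon
  rw [not_lt, top_le_iff] at hcon
  simp [hcon] at h3

/-! ### Time-integrated bounds for the truncated nonlinearity -/

/-- The nonlinearity, cut off outside the time interval `[-T, T]`. -/
def truncSource (χ : ℝ → ℝ) (z : ℝ → ℝ → ℂ) (T τ : ℝ) (V : L2) : L2 :=
  (Icc (-T) T).indicator (fun τ ↦ source χ (z τ) V) τ

theorem truncSource_of_mem {χ : ℝ → ℝ} {z : ℝ → ℝ → ℂ} {T τ : ℝ} (hτ : τ ∈ Icc (-T) T) (V : L2) :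
    truncSource χ z T τ V = source χ (z τ) V := indicator_of_mem hτ _

theorem truncSource_of_notMem {χ : ℝ → ℝ} {z : ℝ → ℝ → ℂ} {T τ : ℝ} (hτ : τ ∉ Icc (-T) T)
    (V : L2) : truncSource χ z T τ V = 0 := indicator_of_notMem hτ _

section

variable {χ : ℝ → ℝ} (hχ : Measurable χ) (hχ0 : ∀ x, 0 ≤ χ x) (hχ2 : MemLp χ 2 volume)
  {z : ℝ → ℝ → ℂ} (hz : Measurable (Function.uncurry z))

include hχ hz in
theorem aestronglyMeasurable_truncSource (T : ℝ) {V : ℝ → L2} (hV : Continuous V) :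
    AEStronglyMeasurable (fun τ ↦ truncSource χ z T τ (V τ)) volume :=
  ((stronglyMeasurable_source hχ hz hV).indicator measurableSet_Icc).aestronglyMeasurable

/-- An integrable function of time, affine in the `L²` norm of `χ |z|³` on `[-T, T]`. -/
def timeWeight (χ : ℝ → ℝ) (z : ℝ → ℝ → ℂ) (T p q τ : ℝ) : ℝ :=
  (Icc (-T) T).indicator (fun τ ↦ p * (cubeNorm χ z τ).toReal + q) τ

theorem timeWeight_nonneg {T p q : ℝ} (hp : 0 ≤ p) (hq : 0 ≤ q) (τ : ℝ) :
    0 ≤ timeWeight χ z T p q τ :=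
  indicator_nonneg (fun τ _ ↦ by positivity) τ

include hχ hz in
theorem memLp_cube_of_lt_top {τ : ℝ} (h : cubeNorm χ z τ < ⊤) :
    MemLp (fun x ↦ χ x * ‖z τ x‖ ^ 3) 2 volume :=
  ⟨(hχ.mul ((hz.comp measurable_prodMk_left).norm.pow_const 3)).aestronglyMeasurable, h⟩

include hχ hχ0 hχ2 hz in
theorem ae_norm_truncSource_le {T : ℝ} (hfin : ∀ᵐ τ, τ ∈ Icc (-T) T → cubeNorm χ z τ < ⊤)
    -- The null set of times does not depend on V, so the bound may be applied along any curve τ ↦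
    -- V(τ) in the ball.
    (R : ℝ) : ∀ᵐ τ, ∀ V, ‖V‖ ≤ R → ‖truncSource χ z T τ V‖ ≤
      timeWeight χ z T 4 (4 * (‖besselL2‖ * R) ^ 3 * (eLpNorm χ 2 volume).toReal) τ := by
  filter_upwards [hfin] with τ h V hV
  by_cases hτ : τ ∈ Icc (-T) T
  · rw [truncSource_of_mem hτ, timeWeight, indicator_of_mem hτ]
    have hw : Measurable (z τ) := hz.comp measurable_prodMk_left
    refine (norm_source_le hχ hχ0 hχ2 hw
      (memLp_cube_of_lt_top hχ hz (h hτ)) V).trans (add_le_add le_rfl ?_)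
    gcongr
  · rw [truncSource_of_notMem hτ, timeWeight, indicator_of_notMem hτ, norm_zero]

include hχ hχ0 hχ2 hz in
theorem ae_norm_truncSource_sub_le {T : ℝ}
    (hfin : ∀ᵐ τ, τ ∈ Icc (-T) T → cubeNorm χ z τ < ⊤) (R : ℝ) {μ : ℝ} (hμ : 0 < μ) :
    ∀ᵐ τ, ∀ V W, ‖V‖ ≤ R → ‖W‖ ≤ R → ‖truncSource χ z T τ V - truncSource χ z T τ W‖ ≤
      timeWeight χ z T (‖besselL2‖ * (6 / μ)) (‖besselL2‖ *
        (6 * μ ^ 2 + 6 * ‖besselL2‖ ^ 2 * R ^ 2) * (eLpNorm χ 2 volume).toReal) τ * ‖V - W‖ := by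
  filter_upwards [hfin] with τ h V W hV hW
  by_cases hτ : τ ∈ Icc (-T) T
  · rw [truncSource_of_mem hτ, truncSource_of_mem hτ, timeWeight, indicator_of_mem hτ]
    have hw : Measurable (z τ) := hz.comp measurable_prodMk_left
    refine (norm_source_sub_le hχ hχ0 hχ2 hw
      (memLp_cube_of_lt_top hχ hz (h hτ)) V W hμ).trans ?_
    have hVR : ‖V‖ ^ 2 ≤ R ^ 2 := pow_le_pow_left₀ (norm_nonneg _) hV 2
    have hWR : ‖W‖ ^ 2 ≤ R ^ 2 := pow_le_pow_left₀ (norm_nonneg _) hW 2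
    rw [show eLpNorm (fun x ↦ χ x * ‖z τ x‖ ^ 3) 2 volume = cubeNorm χ z τ from rfl]
    set κ := ‖besselL2‖
    set X := (eLpNorm χ 2 volume).toReal
    calc κ * ‖V - W‖ * (6 / μ) * (cubeNorm χ z τ).toReal +
          κ * ‖V - W‖ * (6 * μ ^ 2 + 3 * κ ^ 2 * (‖V‖ ^ 2 + ‖W‖ ^ 2)) * X
        ≤ κ * ‖V - W‖ * (6 / μ) * (cubeNorm χ z τ).toReal +
          κ * ‖V - W‖ * (6 * μ ^ 2 + 3 * κ ^ 2 * (R ^ 2 + R ^ 2)) * X := by gcongr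
      _ = _ := by ring
  · rw [truncSource_of_notMem hτ, truncSource_of_notMem hτ, timeWeight, indicator_of_notMem hτ]
    simp

include hχ hz in
theorem integrableOn_cubeNorm {T b : ℝ}
    (h : ∫⁻ τ in Icc (-T) T, cubeNorm χ z τ ≤ ENNReal.ofReal b) :
    IntegrableOn (fun τ ↦ (cubeNorm χ z τ).toReal) (Icc (-T) T) :=
  integrable_toReal_of_lintegral_ne_top (measurable_cubeNorm hχ hz).aemeasurable
    (h.trans_lt ENNReal.ofReal_lt_top).ne

include hχ hz in
theorem integrable_timeWeight {T b : ℝ}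
    (h : ∫⁻ τ in Icc (-T) T, cubeNorm χ z τ ≤ ENNReal.ofReal b) (p q : ℝ) :
    Integrable (timeWeight χ z T p q) := by
  rw [show timeWeight χ z T p q = (Icc (-T) T).indicator
    (fun τ ↦ p * (cubeNorm χ z τ).toReal + q) from rfl, integrable_indicator_iff measurableSet_Icc]
  exact ((integrableOn_cubeNorm hχ hz h).const_mul p).add (integrableOn_const (by simp))

include hχ hz in
theorem integral_timeWeight_le {T b : ℝ} (hT : 0 ≤ T) (hb : 0 ≤ b)
    (h : ∫⁻ τ in Icc (-T) T, cubeNorm χ z τ ≤ ENNReal.ofReal b) {p : ℝ} (hp : 0 ≤ p) (q : ℝ) :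
    ∫ τ, timeWeight χ z T p q τ ≤ p * b + 2 * T * q := by
  have hi := integrableOn_cubeNorm hχ hz h
  have h1 : ∫ τ in Icc (-T) T, (cubeNorm χ z τ).toReal ≤ b := by
    rw [integral_toReal (measurable_cubeNorm hχ hz).aemeasurable
      (ae_lt_top (measurable_cubeNorm hχ hz) (h.trans_lt ENNReal.ofReal_lt_top).ne)]
    exact ENNReal.toReal_le_of_le_ofReal hb h
  rw [show timeWeight χ z T p q = (Icc (-T) T).indicator
    (fun τ ↦ p * (cubeNorm χ z τ).toReal + q) from rfl, integral_indicator measurableSet_Icc,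
    integral_add (hi.const_mul p) (integrableOn_const (by simp)), integral_const_mul,
    setIntegral_const, Real.volume_real_Icc_of_le (by linarith), smul_eq_mul]
  have := mul_le_mul_of_nonneg_left h1 hp
  linarith

end

/-! ### Distributional solutions and mild solutions -/

theorem D_L_comm (s t : ℝ) (u : 𝓢'(ℝ, ℂ)) : D s (L t u) = L t (D s u) := by
  rw [D_eq, L_eq, TemperedDistribution.fourierMultiplierCLM_fourierMultiplierCLM_apply
    (hasTemperateGrowth_phase t) (hasTemperateGrowth_ofReal_japaneseBracket_rpow s),
    TemperedDistribution.fourierMultiplierCLM_fourierMultiplierCLM_apply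
    (hasTemperateGrowth_ofReal_japaneseBracket_rpow s) (hasTemperateGrowth_phase t), mul_comm]

theorem continuous_D_one_L (u : 𝓢'(ℝ, ℂ)) (φ : 𝓢(ℝ, ℂ)) :
    Continuous fun τ ↦ D 1 (L τ u) φ := by
  simp_rw [D_L_comm]
  exact continuous_iff_continuousAt.2 fun t ↦ (hasDerivAt_L_apply (D 1 u) φ t).continuousAt

theorem integral_D_one_L (u : 𝓢'(ℝ, ℂ)) (φ : 𝓢(ℝ, ℂ)) (t : ℝ) :
    ∫ τ in (0 : ℝ)..t, D 1 (L τ u) φ = Complex.I * (L t u φ - u φ) := by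
  have h := intervalIntegral.integral_eq_sub_of_hasDerivAt
    (a := 0) (b := t) (fun s _ ↦ hasDerivAt_L_apply u φ s)
    ((continuous_const.mul (continuous_D_one_L u φ)).intervalIntegrable _ _)
  rw [intervalIntegral.integral_const_mul, L_zero] at h
  rw [← h, ← mul_assoc, mul_neg, Complex.I_mul_I, neg_neg, one_mul]

/-- The distribution `L(t) u₀ + (1 - Δ)^{-1/2} V`. -/
def perturb (u₀ : 𝓢'(ℝ, ℂ)) (t : ℝ) (V : L2) : 𝓢'(ℝ, ℂ) := L t u₀ + D (-1) (V : 𝓢'(ℝ, ℂ))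

theorem D_one_perturb_sub (u₀ : 𝓢'(ℝ, ℂ)) (t : ℝ) (V : L2) :
    D 1 (perturb u₀ t V - L t u₀) = V := by
  rw [perturb, add_sub_cancel_left, D_one_D_neg_one]

theorem perturb_apply (u₀ : 𝓢'(ℝ, ℂ)) (t : ℝ) (V : L2) (φ : 𝓢(ℝ, ℂ)) :
    perturb u₀ t V φ = L t u₀ φ + pairL2 φ (bessel V) := by
  rw [perturb, add_apply, pairL2_apply, coe_bessel]

/-- All of the right-hand side except the linear term D L(t)u₀ is an element of L², so the equation
for V can be studied there. -/
theorem rhs_perturb_apply (u₀ : 𝓢'(ℝ, ℂ)) (t : ℝ) (V N : L2) (φ : 𝓢(ℝ, ℂ)) :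
    (D 1 (perturb u₀ t V) + D (-1) (N : 𝓢'(ℝ, ℂ))) φ =
      D 1 (L t u₀) φ + pairL2 φ (V + bessel N) := by
  rw [perturb, map_add, D_one_D_neg_one, add_apply, add_apply, map_add, pairL2_apply,
    pairL2_apply, coe_bessel, add_assoc]

theorem isFunction_perturb {u₀ : 𝓢'(ℝ, ℂ)} {t : ℝ} {w : ℝ → ℂ} (h : IsFunction (L t u₀) w)
    (V : L2) : IsFunction (perturb u₀ t V) fun x ↦ w x + besselFun V x :=
  h.add (isFunction_D_neg_one V)

section

variable {χ : ℝ → ℝ} (hχ : Measurable χ) (hχ0 : ∀ x, 0 ≤ χ x) (hχ2 : MemLp χ 2 volume)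
  {z : ℝ → ℝ → ℂ} (hz : Measurable (Function.uncurry z)) {T : ℝ}
  (hfin : ∀ᵐ τ, τ ∈ Icc (-T) T → cubeNorm χ z τ < ⊤)
  {u₀ : 𝓢'(ℝ, ℂ)} (hzu : ∀ᵐ τ, τ ∈ Icc (-T) T → IsFunction (L τ u₀) (z τ))

include hχ hχ0 hχ2 hz in
theorem truncSource_ae_eq {τ : ℝ} (hτ : τ ∈ Icc (-T) T) (h : cubeNorm χ z τ < ⊤) (V : L2) :
    truncSource χ z T τ V =ᵐ[volume] cubic χ fun x ↦ z τ x + besselFun V x := by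
  have hw : Measurable (z τ) := hz.comp measurable_prodMk_left
  rw [truncSource_of_mem hτ]
  exact source_ae_eq (memLp_cubic hχ hχ0 hχ2 hw (memLp_cube_of_lt_top hχ hz h) V)

include hχ hχ0 hχ2 hz hfin hzu in
theorem isSolution_perturb {V : ℝ → L2} (hV : Continuous V)
    (hi : Integrable fun τ ↦ truncSource χ z T τ (V τ))
    (hd : ∀ t, V t = duhamel (fun τ ↦ truncSource χ z T τ (V τ)) t) :
    IsSolution χ u₀ T fun t ↦ perturb u₀ t (V t) := by
  have hV0 : V 0 = 0 := by
    rw [hd, duhamel, intervalIntegral.integral_same, map_zero, smul_zero]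
  have h0 : perturb u₀ 0 (V 0) = u₀ := by
    have : ((0 : L2) : 𝓢'(ℝ, ℂ)) = 0 := map_zero (Lp.toTemperedDistributionCLM ℂ volume 2)
    rw [perturb, hV0, this, map_zero, add_zero, L_zero]
  have hsum : ∀ φ : 𝓢(ℝ, ℂ), Integrable fun τ ↦ pairL2 φ (bessel (truncSource χ z T τ (V τ))) :=
    fun φ ↦ ((pairL2 φ).comp bessel).integrable_comp hi
  have hii : ∀ (φ : 𝓢(ℝ, ℂ)) (a b : ℝ), IntervalIntegrable
      (fun τ ↦ pairL2 φ (V τ + bessel (truncSource χ z T τ (V τ)))) volume a b := by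
    intro φ a b
    simp_rw [map_add]
    exact (((pairL2 φ).continuous.comp hV).intervalIntegrable a b).add
      (hsum φ).intervalIntegrable
  refine ⟨h0, fun τ ↦ (truncSource χ z T τ (V τ) : 𝓢'(ℝ, ℂ)), ?_, fun φ ↦ ?_⟩
  · rw [ae_restrict_iff' measurableSet_Icc]
    filter_upwards [hfin, hzu] with τ h₁ h₂ hτ
    exact ⟨_, isFunction_perturb (h₂ hτ) (V τ), (isFunction_coe_Lp _).congr
      (truncSource_ae_eq hχ hχ0 hχ2 hz hτ (h₁ hτ) (V τ))⟩
  · simp_rw [rhs_perturb_apply]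
    refine ⟨((continuous_D_one_L u₀ φ).intervalIntegrable _ _).add (hii φ _ _), fun t _ ↦ ?_⟩
    rw [h0, intervalIntegral.integral_add ((continuous_D_one_L u₀ φ).intervalIntegrable _ _)
      (hii φ _ _), integral_D_one_L, perturb_apply]
    have h1 := congrArg (pairL2 φ) (I_smul_bessel_duhamel hi t)
    rw [← hd t, map_smul, smul_eq_mul] at h1
    have h2 : (fun τ ↦ duhamel (fun τ ↦ truncSource χ z T τ (V τ)) τ +
        bessel (truncSource χ z T τ (V τ))) =
        fun τ ↦ V τ + bessel (truncSource χ z T τ (V τ)) := by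
      ext1 τ
      rw [← hd τ]
    rw [h2, ← (pairL2 φ).intervalIntegral_comp_comm
      ((hV.intervalIntegrable _ _).add (bessel.integrable_comp hi).intervalIntegrable)] at h1
    rw [← h1]
    ring

include hχ hχ0 hχ2 hz hfin hzu in
theorem eq_duhamel_of_isSolution {u : ℝ → 𝓢'(ℝ, ℂ)} (hu : IsSolution χ u₀ T u)
    {V : ℝ → L2} (hV : Continuous V) (huV : ∀ t ∈ Icc (-T) T, u t = perturb u₀ t (V t))
    (hi : Integrable fun τ ↦ truncSource χ z T τ (V τ)) :
    ∀ t ∈ Icc (-T) T, V t = duhamel (fun τ ↦ truncSource χ z T τ (V τ)) t := by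
  obtain ⟨hu0, N, hN, hsol⟩ := hu
  rw [ae_restrict_iff' measurableSet_Icc] at hN
  -- The nonlinear distribution of an arbitrary solution is forced: functions representing u(τ)
  -- agree almost everywhere, hence so do their weighted cubes.
  have hNeq : ∀ᵐ τ, τ ∈ Icc (-T) T → N τ = (truncSource χ z T τ (V τ) : 𝓢'(ℝ, ℂ)) := by
    filter_upwards [hfin, hzu, hN] with τ h₁ h₂ h₃ hτ
    obtain ⟨f, hf, hNf⟩ := h₃ hτ
    rw [huV τ hτ] at hf
    have hff := hf.ae_eq (isFunction_perturb (h₂ hτ) (V τ))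
    refine hNf.eq (isFunction_coe_Lp _) ?_
    filter_upwards [hff, truncSource_ae_eq hχ hχ0 hχ2 hz hτ (h₁ hτ) (V τ)] with x hx hx'
    rw [hx', hx]
    rfl
  have hint : ∀ a b : ℝ, IntervalIntegrable
      (fun τ ↦ V τ + bessel (truncSource χ z T τ (V τ))) volume a b := fun a b ↦
    (hV.intervalIntegrable _ _).add (bessel.integrable_comp hi).intervalIntegrable
  -- Testing against every Schwartz function reduces the L² identity to the given scalar one; the
  -- linear flow cancels through `integral_D_one_L`.
  refine eq_duhamel_of_I_smul_bessel_eq hV hi fun t ht ↦ eq_of_forall_pairL2_eq fun φ ↦ ?_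
  have hmem : ∀ τ ∈ uIoc 0 t, τ ∈ Icc (-T) T := by
    have h1 := ht.1.trans ht.2
    intro τ hτ
    exact uIcc_subset_Icc ⟨by linarith, by linarith⟩ ht (uIoc_subset_uIcc hτ)
  have h1 := (hsol φ).2 t ht
  have h2 : ∫ τ in (0 : ℝ)..t, (D 1 (u τ) + D (-1) (N τ)) φ =
      ∫ τ in (0 : ℝ)..t, (D 1 (L τ u₀) φ +
        pairL2 φ (V τ + bessel (truncSource χ z T τ (V τ)))) := by
    refine intervalIntegral.integral_congr_ae ?_
    filter_upwards [hNeq] with τ h hτ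
    rw [h (hmem τ hτ), huV τ (hmem τ hτ), rhs_perturb_apply]
  have hpi : IntervalIntegrable (fun τ ↦ pairL2 φ (V τ + bessel (truncSource χ z T τ (V τ))))
      volume 0 t := by
    have := hint 0 t
    rw [intervalIntegrable_iff] at this ⊢
    exact (pairL2 φ).integrable_comp this
  rw [h2, intervalIntegral.integral_add ((continuous_D_one_L u₀ φ).intervalIntegrable _ _) hpi,
    integral_D_one_L, hu0, huV t ht, perturb_apply,
    (pairL2 φ).intervalIntegral_comp_comm (hint 0 t)] at h1
  rw [map_smul, smul_eq_mul]
  linear_combination h1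

end

/-- A function that is continuous on `[-T, T]`, extended by its boundary values. -/
theorem exists_continuous_extension {T : ℝ} (hT : 0 ≤ T) {V : ℝ → L2}
    (hV : ContinuousOn V (Icc (-T) T)) : ∃ W : ℝ → L2, Continuous W ∧ EqOn W V (Icc (-T) T) ∧
      ∃ R, ∀ t, ‖W t‖ ≤ R := by
  have hle : -T ≤ T := by linarith
  refine ⟨IccExtend hle ((Icc (-T) T).domRestrict V), hV.domRestrict.Icc_extend', fun t ht ↦ ?_, ?_⟩
  · rw [IccExtend_of_mem hle _ ht]; rfl
  · obtain ⟨R, hR⟩ := isCompact_Icc.exists_bound_of_continuousOn hV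
    exact ⟨R, fun t ↦ hR _ (projIcc (-T) T hle t).2⟩

theorem h1Norm_le {f : 𝓢'(ℝ, ℂ)} {V : L2} (h : D 1 f = V) {r : ℝ} (hr : ‖V‖ ≤ r) :
    h1Norm f ≤ ENNReal.ofReal r := by
  refine (iInf₂_le V h).trans ?_
  rw [← ofReal_norm]
  exact ENNReal.ofReal_le_ofReal hr

end KleinGordon

end

/-! ### Choice of the constants and proof of the theorem -/

open KleinGordon in
theorem mainTheorem5 (χ : ℝ → ℝ) (hχ_meas : Measurable χ) (hχ_nonneg : ∀ x, 0 ≤ χ x)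
    (hχ_decay : ∃ c α : ℝ, 1 < α ∧ ∀ x, χ x ≤ c * √(1 + x ^ 2) ^ (-(3 * α))) :
    ∃ C : ℝ, 1 ≤ C ∧ ∀ Λ : ℝ, 1 ≤ Λ → ∀ ε : ℝ, 0 < ε → ε ≤ √Λ →
      ∀ T : ℝ, T = ε ^ 2 / (C * Λ ^ 4) →
      ∀ u₀ : 𝓢'(ℝ, ℂ), MemHHalfLoc u₀ → LinearFlowBound χ u₀ Λ →
        ∃ ψ : ℝ → 𝓢'(ℝ, ℂ),
          (IsSolution χ u₀ T ψ ∧ IsContinuousInH1 T (fun t ↦ ψ t - L t u₀)) ∧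
          (∀ u : ℝ → 𝓢'(ℝ, ℂ),
            IsSolution χ u₀ T u → IsContinuousInH1 T (fun t ↦ u t - L t u₀) →
              EqOn u ψ (Icc (-T) T)) ∧
          ∀ t ∈ Icc (-T) T, h1Norm (ψ t - L t u₀) ≤ ENNReal.ofReal (ε * Λ) := by
  obtain ⟨c, α, hα, hdecay⟩ := hχ_decay
  have hχ2 := memLp_two_of_decay hχ_meas hχ_nonneg hα hdecay
  set κ : ℝ := ‖besselL2‖ with hκ
  set X : ℝ := (eLpNorm χ 2 volume).toReal with hX
  have hκ0 : 0 ≤ κ := norm_nonneg _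
  have hX0 : 0 ≤ X := ENNReal.toReal_nonneg
  -- The second condition makes the Duhamel map preserve the ball, the third makes its Lipschitz
  -- constant at most 1/2; then C = a⁴.
  obtain ⟨a, ha1, ha2, ha3⟩ : ∃ a : ℝ, 1 ≤ a ∧ 12 + 8 * κ ^ 3 * X ≤ a ∧
      12 * κ * (3 + 2 * X + 2 * κ ^ 2 * X) ≤ a := by
    refine ⟨1 + (12 + 8 * κ ^ 3 * X) + 12 * κ * (3 + 2 * X + 2 * κ ^ 2 * X), ?_, ?_, ?_⟩
    all_goals
      have h1 : 0 ≤ 8 * κ ^ 3 * X := by positivity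
      have h2 : 0 ≤ 12 * κ * (3 + 2 * X + 2 * κ ^ 2 * X) := by positivity
      linarith
  have ha0 : 0 < a := by linarith
  refine ⟨a ^ 4, one_le_pow₀ ha1, ?_⟩
  rintro Λ hΛ ε hε hεΛ T hT u₀ - ⟨z, hz, hzu, hbound⟩
  have hΛ0 : 0 < Λ := by linarith
  have hε2 : ε ^ 2 ≤ Λ := by
    have := pow_le_pow_left₀ hε.le hεΛ 2
    rwa [Real.sq_sqrt hΛ0.le] at this
  -- This is √T, so that σΛ³ = εΛ/a² is a small fraction of the radius.
  set σ : ℝ := ε / (a ^ 2 * Λ ^ 2) with hσ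
  have hσ0 : 0 < σ := by positivity
  have hTσ : T = σ ^ 2 := by rw [hT, hσ]; field_simp
  have hT0 : 0 < T := by rw [hTσ]; positivity
  have hT1 : T ≤ 1 := by
    rw [hT, div_le_one (by positivity)]
    calc ε ^ 2 ≤ Λ := hε2
      _ = 1 * Λ ^ 1 := by ring
      _ ≤ a ^ 4 * Λ ^ 4 := by
        gcongr
        · exact one_le_pow₀ ha1
        · norm_num
  have hσ1 : σ ≤ 1 := by
    rw [hTσ] at hT1
    exact (sq_le_one_iff₀ hσ0.le).1 hT1
  have hsq := lintegral_cubeNorm_sq_le hχ_nonneg hbound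
  have hfin := ae_cubeNorm_lt_top hχ_meas hz hT1 hsq
  have hint := lintegral_cubeNorm_le hΛ0 hσ0 hσ1 hsq
  rw [← hTσ] at hint
  have hb0 : 0 ≤ 3 * σ * Λ ^ 3 := by positivity
  have hzu' : ∀ᵐ τ, τ ∈ Icc (-T) T → IsFunction (L τ u₀) (z τ) := by
    rw [ae_restrict_iff' measurableSet_Icc] at hzu
    filter_upwards [hzu] with τ h hτ
    exact h ⟨by linarith [hτ.1], by linarith [hτ.2]⟩
  set R : ℝ := ε * Λ with hR
  have hR0 : 0 ≤ R := by positivity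
  -- With this threshold Tμ² = 1/a² and σΛ³/μ = (ε²/Λ)/a³, so both parts of the Lipschitz weight are
  -- small; the second part uses ε² ≤ Λ.
  set μ : ℝ := a * Λ ^ 2 / ε with hμ
  have hμ0 : 0 < μ := by positivity
  have hinv : ∀ k : ℕ, k ≠ 0 → 1 / a ^ k ≤ 1 / a := fun k hk ↦
    one_div_le_one_div_of_le ha0 (le_self_pow₀ ha1 hk)
  have hσR : σ * Λ ^ 3 = R * (1 / a ^ 2) := by rw [hσ, hR]; field_simp
  have hTμ : T * μ ^ 2 ≤ 1 / a := by
    refine le_trans (le_of_eq ?_) (hinv 2 two_ne_zero)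
    rw [hT, hμ]; field_simp
  have hTR : T * R ^ 2 ≤ 1 / a := by
    refine le_trans ?_ (hinv 4 four_ne_zero)
    have e : T * R ^ 2 = (ε ^ 2 / Λ) ^ 2 * (1 / a ^ 4) := by rw [hT, hR]; field_simp
    rw [e]
    exact mul_le_of_le_one_left (by positivity)
      (pow_le_one₀ (by positivity) ((div_le_one hΛ0).2 hε2))
  have hμσ : σ * Λ ^ 3 / μ ≤ 1 / a := by
    refine le_trans ?_ (hinv 3 three_ne_zero)
    have e : σ * Λ ^ 3 / μ = (ε ^ 2 / Λ) * (1 / a ^ 3) := by rw [hσ, hμ]; field_simp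
    rw [e]
    exact mul_le_of_le_one_left (by positivity) ((div_le_one hΛ0).2 hε2)
  have hgle : ∫ τ, timeWeight χ z T 4 (4 * (κ * R) ^ 3 * X) τ ≤ R := by
    refine (integral_timeWeight_le hχ_meas hz hT0.le hb0 hint (by norm_num) _).trans ?_
    calc 4 * (3 * σ * Λ ^ 3) + 2 * T * (4 * (κ * R) ^ 3 * X)
        = 12 * (σ * Λ ^ 3) + 8 * κ ^ 3 * X * R * (T * R ^ 2) := by ring
      _ ≤ 12 * (R * (1 / a)) + 8 * κ ^ 3 * X * R * (1 / a) := by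
        rw [hσR]
        have := hinv 2 two_ne_zero
        gcongr
      _ = R * ((12 + 8 * κ ^ 3 * X) / a) := by ring
      _ ≤ R := mul_le_of_le_one_right hR0 ((div_le_one ha0).2 ha2)
  have hℓle : ∫ τ, timeWeight χ z T (κ * (6 / μ))
      (κ * (6 * μ ^ 2 + 6 * κ ^ 2 * R ^ 2) * X) τ ≤ 1 / 2 := by
    refine (integral_timeWeight_le hχ_meas hz hT0.le hb0 hint (by positivity) _).trans ?_
    calc κ * (6 / μ) * (3 * σ * Λ ^ 3) + 2 * T * (κ * (6 * μ ^ 2 + 6 * κ ^ 2 * R ^ 2) * X)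
        = 18 * κ * (σ * Λ ^ 3 / μ) + 12 * κ * X * (T * μ ^ 2) +
          12 * κ ^ 3 * X * (T * R ^ 2) := by ring
      _ ≤ 18 * κ * (1 / a) + 12 * κ * X * (1 / a) + 12 * κ ^ 3 * X * (1 / a) := by gcongr
      _ = 1 / 2 * (12 * κ * (3 + 2 * X + 2 * κ ^ 2 * X) / a) := by ring
      _ ≤ 1 / 2 := mul_le_of_le_one_right (by norm_num) ((div_le_one ha0).2 ha3)
  obtain ⟨V, hVc, hVR, hVi, hVd⟩ := exists_mild_solution hR0
    (fun V hV ↦ aestronglyMeasurable_truncSource hχ_meas hz T hV)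
    (integrable_timeWeight hχ_meas hz hint _ _)
    (ae_norm_truncSource_le hχ_meas hχ_nonneg hχ2 hz hfin R) hgle
    (integrable_timeWeight hχ_meas hz hint _ _)
    (timeWeight_nonneg (by positivity) (by positivity))
    (ae_norm_truncSource_sub_le hχ_meas hχ_nonneg hχ2 hz hfin R hμ0) hℓle
  refine ⟨fun t ↦ perturb u₀ t (V t),
    ⟨isSolution_perturb hχ_meas hχ_nonneg hχ2 hz hfin hzu' hVc hVi hVd,
      V, hVc.continuousOn, fun t _ ↦ D_one_perturb_sub u₀ t (V t)⟩, ?_,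
    fun t _ ↦ h1Norm_le (D_one_perturb_sub u₀ t (V t)) (hVR t)⟩
  rintro u hu ⟨W₀, hW₀c, hW₀⟩
  -- A competing solution need not lie in the ball of radius R, but continuity on a compact interval
  -- bounds it by some R₁.
  obtain ⟨W, hWc, hWeq, R₁, hWR₁⟩ := exists_continuous_extension hT0.le hW₀c
  have huW : ∀ t ∈ Icc (-T) T, u t = perturb u₀ t (W t) := by
    intro t ht
    rw [perturb, hWeq ht, ← hW₀ t ht, D_neg_one_D_one, add_sub_cancel]
  have hWi : MeasureTheory.Integrable fun τ ↦ truncSource χ z T τ (W τ) :=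
    (integrable_timeWeight hχ_meas hz hint _ _).mono'
      (aestronglyMeasurable_truncSource hχ_meas hz T hWc)
      ((ae_norm_truncSource_le hχ_meas hχ_nonneg hχ2 hz hfin R₁).mono fun τ h ↦ h _ (hWR₁ τ))
  have hWd := eq_duhamel_of_isSolution hχ_meas hχ_nonneg hχ2 hz hfin hzu' hu hWc huW hWi
  -- Uniqueness only needs an integrable Lipschitz weight, not a small one, so μ = 1 and the larger
  -- radius max(R, R₁) will do.
  have hWV := mild_solution_unique hT0.le (integrable_timeWeight hχ_meas hz hint _ _)
    (timeWeight_nonneg (by positivity) (by positivity))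
    (ae_norm_truncSource_sub_le hχ_meas hχ_nonneg hχ2 hz hfin (max R R₁) one_pos) hWc hVc
    (fun t ↦ (hWR₁ t).trans (le_max_right _ _)) (fun t ↦ (hVR t).trans (le_max_left _ _))
    hWi hVi hWd (fun t _ ↦ hVd t)
  intro t ht
  rw [huW t ht, hWV ht]
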